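/- **Lemma 3.11 (Eilenberg swindles).** Let $X$ be a separable Hausdorff topological space with a coarse structure $\mathcal E$ on $X$, i.e. a family $\mathcal E$ of subsets of $X\times X$, called controlled sets, that contains the diagonal and is closed under passing to subsets, finite unions, inverses and compositions. Call $B\subseteq X$ bounded if $B\times B$ is controlled. Assume that $\mathcal E$ is proper: there is a controlled open neighbourhood of the diagonal, and every bounded subset of $X$ is relatively compact. Let $p\in[1,\infty)$, let $Z\subseteq X$ be any countable dense subset, and let $E=\ell^p(Z)\otimes\ell^p(\mathbb N)=\ell^p(Z\times\mathbb N)$ (complex coefficients), on which the characteristic function $\chi_U$ of $U\subseteq X$ acts by multiplication. The support $\operatorname{supp}(T)$ of a bounded operator $T$ on $E$ is the set of all $(x,y)\in X\times X$ with $\chi_V T\chi_U\neq 0$ for all open neighbourhoods $U$ of $x$ and $V$ of $y$; $T$ is controlled if $\operatorname{supp}(T)$ is controlled, and locally compact if $\chi_KT$ and $T\chi_K$ are compact operators for every compact $K\subseteq X$. The $L^p$ Roe algebra $B^p(X)$ is the operator norm closure of the algebra of all locally compact, controlled operators on $E$. Let $(\alpha_k)_{k\ge 0}$ be a sequence of coarse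 maps $X\to X$ (that is, for each $k$, preimages of bounded sets under $\alpha_k$ are bounded, and $\alpha_k\times\alpha_k$ maps controlled sets to controlled sets) with $\alpha_0=\mathrm{id}_X$. Suppose that $(\alpha_k)$ - is properly supported: for every bounded set $B$, $B\cap\operatorname{Range}(\alpha_k)\ne\emptyset$ for only finitely many $k$; - is uniformly controlled: for every controlled set $A$ there is a controlled set $B_A$ such that $(x,x')\in A$ implies $(\alpha_k(x),\alpha_k(x'))\in B_A$ for all $k$; - has uniformly close steps: there is a controlled set $C$ such that $(\alpha_k(x),\alpha_{k+1}(x))\in C$ for all $k$ and all $x\in X$. Then $K_*(B^p(X))=0$, i.e. $K_0(B^p(X))=0$ and $K_1(B^p(X))=0$. Here, for a complex Banach algebra $A$ with unitization $A^+=\mathbb C\oplus A$, $K_0(A)$ is the kernel of $K_0(A^+)\to K_0(\mathbb C)$, where $K_0$ of a unital ring is the Grothendieck group of the monoid of equivalence classes of idempotent matrices ($e\sim f$ if $e=xy$ and $f=yx$ for some rectangular matrices $x,y$) under block sum; and $K_1(A)=\varinjlim_n GL_n(A)/GL_n(A)_0$, where $GL_n(A)$ is the group of invertible $n\times n$ matrices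 over $A^+$ congruent to the identity modulo $A$, and $GL_n(A)_0$ is the connected component of the identity. -/

import Mathlib

open Set Topology
open scoped ENNReal

/-! ### Coarse spaces -/

/-- A coarse structure on a set `X`: a family of subsets of `X × X` (the controlled sets) that
contains the diagonal and is closed under subsets, finite unions, inverses and compositions. -/
structure CoarseStructure (X : Type*) where
  /-- The family of controlled sets. -/
  controlled : Set (Set (X × X))
  diagonal_mem : diagonal X ∈ controlled
  subset_mem : ∀ {E F : Set (X × X)}, E ∈ controlled → F ⊆ E → F ∈ controlled
  union_mem : ∀ {E F : Set (X × X)}, E ∈ controlled → F ∈ controlled → E ∪ F ∈ controlled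
  inv_mem : ∀ {E : Set (X × X)}, E ∈ controlled → {q : X × X | (q.2, q.1) ∈ E} ∈ controlled
  comp_mem : ∀ {E F : Set (X × X)}, E ∈ controlled → F ∈ controlled →
    {q : X × X | ∃ z, (q.1, z) ∈ E ∧ (z, q.2) ∈ F} ∈ controlled

namespace CoarseStructure

/-- A set `B` is bounded if `B × B` is controlled. -/
def IsBounded {X : Type*} (𝓔 : CoarseStructure X) (B : Set X) : Prop :=
  B ×ˢ B ∈ 𝓔.controlled

/-- A coarse structure on a topological space is proper if there is a controlled neighbourhood of
the diagonal and every bounded set is relatively compact. -/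
structure IsProper {X : Type*} [TopologicalSpace X] (𝓔 : CoarseStructure X) : Prop where
  exists_open : ∃ O ∈ 𝓔.controlled, IsOpen O ∧ diagonal X ⊆ O
  isCompact_closure : ∀ B : Set X, 𝓔.IsBounded B → IsCompact (closure B)

/-- A coarse map: preimages of bounded sets are bounded (`f` is proper), and `f × f` maps
controlled sets to controlled sets (`f` is bornologous). -/
structure IsCoarseMap {X Y : Type*} (𝓔 : CoarseStructure X) (𝓕 : CoarseStructure Y) (f : X → Y) :
    Prop where
  proper : ∀ B : Set Y, 𝓕.IsBounded B → 𝓔.IsBounded (f ⁻¹' B)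
  bornologous : ∀ E ∈ 𝓔.controlled, Prod.map f f '' E ∈ 𝓕.controlled

/-- Every bounded set meets the range of `α k` for only finitely many `k`. -/
def ProperlySupported {X : Type*} (𝓔 : CoarseStructure X) (α : ℕ → X → X) : Prop :=
  ∀ B : Set X, 𝓔.IsBounded B → {k : ℕ | (B ∩ range (α k)).Nonempty}.Finite

/-- The maps `α k` are bornologous uniformly in `k`. -/
def UniformlyControlled {X : Type*} (𝓔 : CoarseStructure X) (α : ℕ → X → X) : Prop :=
  ∀ A ∈ 𝓔.controlled, ∃ B ∈ 𝓔.controlled,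
    ∀ (k : ℕ) (x x' : X), (x, x') ∈ A → (α k x, α k x') ∈ B

/-- Consecutive maps `α k`, `α (k + 1)` are close, uniformly in `k`. -/
def UniformlyCloseSteps {X : Type*} (𝓔 : CoarseStructure X) (α : ℕ → X → X) : Prop :=
  ∃ C ∈ 𝓔.controlled, ∀ (k : ℕ) (x : X), (α k x, α (k + 1) x) ∈ C

end CoarseStructure

/-! ### The `L^p` Roe algebra -/

/-- The `L^p`-`X`-module `ℓ^p(Z) ⊗ ℓ^p = ℓ^p(Z × ℕ)` attached to a set `Z` (countable and dense in
`X` in the applications). -/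
abbrev LpModule {X : Type*} (Z : Set X) (p : ℝ≥0∞) : Type _ := lp (fun _ : Z × ℕ => ℂ) p

/-- Multiplication by the characteristic function of `U ⊆ X` on `ℓ^p(Z × ℕ)`. -/
noncomputable def chi {X : Type*} (Z : Set X) (p : ℝ≥0∞) [Fact (1 ≤ p)] (U : Set X) :
    LpModule Z p →L[ℂ] LpModule Z p :=
  LinearMap.mkContinuous
    { toFun := fun ξ => ⟨indicator {a : Z × ℕ | (a.1 : X) ∈ U} (ξ : Z × ℕ → ℂ),
        (lp.memℓp ξ).mono' fun a => norm_indicator_le_norm_self _ _⟩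
      map_add' := fun ξ η => lp.ext (indicator_add _ (ξ : Z × ℕ → ℂ) (η : Z × ℕ → ℂ))
      map_smul' := fun c ξ => lp.ext (indicator_const_smul _ c (ξ : Z × ℕ → ℂ)) }
    1 fun ξ => by
      rw [one_mul]
      exact lp.norm_mono (zero_lt_one.trans_le Fact.out).ne'
        fun a => norm_indicator_le_norm_self _ _

theorem chi_apply {X : Type*} (Z : Set X) (p : ℝ≥0∞) [Fact (1 ≤ p)] (U : Set X)
    (ξ : LpModule Z p) (a : Z × ℕ) :
    (chi Z p U ξ : Z × ℕ → ℂ) a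
      = indicator {a : Z × ℕ | (a.1 : X) ∈ U} (ξ : Z × ℕ → ℂ) a := rfl

/-- The support of an operator `T`: all `(x, y)` such that `χ_V T χ_U ≠ 0` for all open
neighbourhoods `U` of `x` and `V` of `y`. -/
def opSupport {X : Type*} [TopologicalSpace X] {Z : Set X} {p : ℝ≥0∞} [Fact (1 ≤ p)]
    (T : LpModule Z p →L[ℂ] LpModule Z p) : Set (X × X) :=
  {q | ∀ U V : Set X, IsOpen U → q.1 ∈ U → IsOpen V → q.2 ∈ V →
    chi Z p V ∘L T ∘L chi Z p U ≠ 0}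

/-- An operator is controlled if its support is a controlled set. -/
def IsControlledOp {X : Type*} [TopologicalSpace X] (𝓔 : CoarseStructure X) {Z : Set X} {p : ℝ≥0∞}
    [Fact (1 ≤ p)] (T : LpModule Z p →L[ℂ] LpModule Z p) : Prop :=
  opSupport T ∈ 𝓔.controlled

/-- `T` is locally compact if `χ_K T` and `T χ_K` are compact operators for all compact `K ⊆ X`. -/
def IsLocallyCompactOp {X : Type*} [TopologicalSpace X] {Z : Set X} {p : ℝ≥0∞} [Fact (1 ≤ p)]
    (T : LpModule Z p →L[ℂ] LpModule Z p) : Prop :=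
  ∀ K : Set X, IsCompact K →
    IsCompactOperator (chi Z p K ∘L T) ∧ IsCompactOperator (T ∘L chi Z p K)

section Support

variable {X : Type*} {Z : Set X} {p : ℝ≥0∞} [Fact (1 ≤ p)]

theorem chi_single_of_mem [DecidableEq (Z × ℕ)] {U : Set X} {a : Z × ℕ} (ha : (a.1 : X) ∈ U) (c : ℂ) :
    chi Z p U (lp.single p a c) = lp.single p a c := by
  classical
  ext b
  rw [chi_apply, indicator_apply]
  split_ifs with h
  · rfl
  · have hb : b ≠ a := by rintro rfl; exact h ha
    simp [Pi.single_eq_of_ne hb]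

theorem chi_single_of_notMem [DecidableEq (Z × ℕ)] {U : Set X} {a : Z × ℕ} (ha : (a.1 : X) ∉ U) (c : ℂ) :
    chi Z p U (lp.single p a c) = 0 := by
  classical
  ext b
  rw [chi_apply, indicator_apply]
  split_ifs with h
  · have hb : b ≠ a := by rintro rfl; exact ha h
    simp [Pi.single_eq_of_ne hb]
  · rfl

/-- A nonzero matrix entry of a product comes from nonzero entries of the factors. -/
theorem exists_entry_comp [DecidableEq (Z × ℕ)] (hp : p ≠ ∞) (S T : LpModule Z p →L[ℂ] LpModule Z p) (a b : Z × ℕ)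
    (h : (S (T (lp.single p a 1)) : Z × ℕ → ℂ) b ≠ 0) :
    ∃ c : Z × ℕ, (T (lp.single p a 1) : Z × ℕ → ℂ) c ≠ 0 ∧
      (S (lp.single p c 1) : Z × ℕ → ℂ) b ≠ 0 := by
  classical
  by_contra! hcon
  apply h
  set η := T (lp.single p a 1) with hη
  have hs := (lp.hasSum_single hp η).mapL ((lp.evalCLM ℂ (fun _ : Z × ℕ => ℂ) p b) ∘L S)
  refine hs.unique ?_
  convert hasSum_zero using 1
  ext c
  by_cases hc : (η : Z × ℕ → ℂ) c = 0
  · rw [hc]; simp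
  · have h1 : lp.single p c ((η : Z × ℕ → ℂ) c)
        = (η : Z × ℕ → ℂ) c • (lp.single p c (1 : ℂ) : LpModule Z p) := by
      rw [← lp.single_smul]; simp
    rw [h1, map_smul]
    have h2 := hcon c hc
    simp only [ContinuousLinearMap.comp_apply]
    change _ • (S (lp.single p c 1) : Z × ℕ → ℂ) b = 0
    rw [h2, smul_zero]

/-- A block `χ_V T χ_U` that does not vanish has a nonzero matrix entry. -/
theorem exists_entry_of_ne_zero [DecidableEq (Z × ℕ)] (hp : p ≠ ∞) (T : LpModule Z p →L[ℂ] LpModule Z p) {U V : Set X}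
    (h : chi Z p V ∘L T ∘L chi Z p U ≠ 0) :
    ∃ a b : Z × ℕ, (a.1 : X) ∈ U ∧ (b.1 : X) ∈ V ∧
      (T (lp.single p a 1) : Z × ℕ → ℂ) b ≠ 0 := by
  classical
  by_contra! hcon
  apply h
  refine lp.ext_continuousLinearMap hp fun a => ?_
  ext b
  simp only [ContinuousLinearMap.comp_apply, lp.singleContinuousLinearMap_apply,
    _root_.zero_apply]
  by_cases ha : (a.1 : X) ∈ U
  · rw [chi_single_of_mem ha, chi_apply, indicator_apply]
    split_ifs with hb
    · exact hcon a b ha hb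
    · rfl
  · rw [chi_single_of_notMem ha]
    simp

variable [TopologicalSpace X]

/-- A nonzero matrix entry gives a point of the support. -/
theorem mem_opSupport_of_entry [DecidableEq (Z × ℕ)] (T : LpModule Z p →L[ℂ] LpModule Z p) (a b : Z × ℕ)
    (h : (T (lp.single p a 1) : Z × ℕ → ℂ) b ≠ 0) : ((a.1 : X), (b.1 : X)) ∈ opSupport T := by
  intro U V _ hU _ hV h0
  have h1 := DFunLike.congr_fun h0 (lp.single p a 1)
  simp only [ContinuousLinearMap.comp_apply, _root_.zero_apply] at h1
  rw [chi_single_of_mem hU] at h1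
  have h2 : (chi Z p V (T (lp.single p a 1)) : Z × ℕ → ℂ) b = 0 := by rw [h1]; rfl
  rw [chi_apply, indicator_of_mem (show b ∈ {a : Z × ℕ | (a.1 : X) ∈ V} from hV)] at h2
  exact h h2

theorem opSupport_zero : opSupport (0 : LpModule Z p →L[ℂ] LpModule Z p) = ∅ := by
  ext q
  simp only [opSupport, mem_ofPred_eq, mem_empty_iff_false, iff_false]
  intro h
  exact h univ univ isOpen_univ (mem_univ _) isOpen_univ (mem_univ _) (by simp)

theorem opSupport_add_subset (S T : LpModule Z p →L[ℂ] LpModule Z p) :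
    opSupport (S + T) ⊆ opSupport S ∪ opSupport T := by
  intro q hq
  by_contra hcon
  simp only [mem_union, opSupport, mem_ofPred_eq, not_or] at hcon
  push Not at hcon
  obtain ⟨⟨U, V, hU, hxU, hV, hyV, h1⟩, ⟨U', V', hU', hxU', hV', hyV', h2⟩⟩ := hcon
  refine hq (U ∩ U') (V ∩ V') (hU.inter hU') ⟨hxU, hxU'⟩ (hV.inter hV') ⟨hyV, hyV'⟩ ?_
  have hi : ∀ A B : Set X, chi Z p (A ∩ B) = chi Z p A ∘L chi Z p B := by
    intro A B
    ext ξ b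
    simp only [ContinuousLinearMap.comp_apply, chi_apply]
    classical
    simp only [indicator_apply, mem_ofPred_eq, mem_inter_iff, chi_apply]
    split_ifs <;> tauto
  have hi' : ∀ A B : Set X, chi Z p (A ∩ B) = chi Z p B ∘L chi Z p A := by
    intro A B; rw [inter_comm, hi]
  have e1 : ∀ ξ, chi Z p V (S (chi Z p U ξ)) = 0 := fun ξ => DFunLike.congr_fun h1 ξ
  have e2 : ∀ ξ, chi Z p V' (T (chi Z p U' ξ)) = 0 := fun ξ => DFunLike.congr_fun h2 ξ
  ext1 ξ
  have f1 : chi Z p (V ∩ V') (S (chi Z p (U ∩ U') ξ)) = 0 := by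
    rw [hi' V V', hi U U']
    simp only [ContinuousLinearMap.comp_apply, e1, map_zero]
  have f2 : chi Z p (V ∩ V') (T (chi Z p (U ∩ U') ξ)) = 0 := by
    rw [hi V V', hi' U U']
    simp only [ContinuousLinearMap.comp_apply, e2, map_zero]
  simp only [ContinuousLinearMap.comp_apply, _root_.add_apply, map_add, f1, f2,
    add_zero, _root_.zero_apply]

theorem opSupport_smul_subset (c : ℂ) (T : LpModule Z p →L[ℂ] LpModule Z p) :
    opSupport (c • T) ⊆ opSupport T := by
  intro q hq U V hU hxU hV hyV h0
  refine hq U V hU hxU hV hyV ?_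
  rw [ContinuousLinearMap.smul_comp, ContinuousLinearMap.comp_smul, h0, smul_zero]

theorem IsControlledOp.mul {𝓔 : CoarseStructure X} (h𝓔 : 𝓔.IsProper) (hp : p ≠ ∞)
    {S T : LpModule Z p →L[ℂ] LpModule Z p} (hS : IsControlledOp 𝓔 S) (hT : IsControlledOp 𝓔 T) :
    IsControlledOp 𝓔 (S * T) := by
  classical
  obtain ⟨O, hO, hOo, hOd⟩ := h𝓔.exists_open
  refine 𝓔.subset_mem
    (𝓔.comp_mem hO (𝓔.comp_mem hT (𝓔.comp_mem hS (𝓔.inv_mem hO)))) fun q hq => ?_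
  have hU : IsOpen {u : X | (q.1, u) ∈ O} := hOo.preimage (Continuous.prodMk_right q.1)
  have hV : IsOpen {v : X | (q.2, v) ∈ O} := hOo.preimage (Continuous.prodMk_right q.2)
  have hne := hq _ _ hU (hOd (mem_diagonal q.1)) hV (hOd (mem_diagonal q.2))
  obtain ⟨a, b, ha, hb, hab⟩ := exists_entry_of_ne_zero hp (S * T) hne
  obtain ⟨c, hc1, hc2⟩ := exists_entry_comp hp S T a b hab
  exact ⟨a.1, ha, c.1, mem_opSupport_of_entry T a c hc1, b.1, mem_opSupport_of_entry S c b hc2, hb⟩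

end Support

/-- The algebra of all locally compact, controlled operators on `ℓ^p(Z × ℕ)`. -/
noncomputable def algebraicRoe {X : Type*} [TopologicalSpace X] (𝓔 : CoarseStructure X) (h𝓔 : 𝓔.IsProper)
    (Z : Set X) (p : ℝ≥0∞) [Fact (1 ≤ p)] (hp : p ≠ ∞) :
    NonUnitalSubalgebra ℂ (LpModule Z p →L[ℂ] LpModule Z p) where
  carrier := {T | IsLocallyCompactOp T ∧ IsControlledOp 𝓔 T}
  zero_mem' := by
    refine ⟨fun K _ => ⟨?_, ?_⟩, ?_⟩
    · rw [ContinuousLinearMap.comp_zero]; exact isCompactOperator_zero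
    · rw [ContinuousLinearMap.zero_comp]; exact isCompactOperator_zero
    · exact 𝓔.subset_mem 𝓔.diagonal_mem (by rw [opSupport_zero]; exact empty_subset _)
  add_mem' := by
    rintro S T ⟨hS, hS'⟩ ⟨hT, hT'⟩
    refine ⟨fun K hK => ⟨?_, ?_⟩, 𝓔.subset_mem (𝓔.union_mem hS' hT') (opSupport_add_subset S T)⟩
    · rw [ContinuousLinearMap.comp_add]; exact (hS K hK).1.add (hT K hK).1
    · rw [ContinuousLinearMap.add_comp]; exact (hS K hK).2.add (hT K hK).2
  smul_mem' := by
    rintro c T ⟨hT, hT'⟩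
    refine ⟨fun K hK => ⟨?_, ?_⟩, 𝓔.subset_mem hT' (opSupport_smul_subset c T)⟩
    · rw [ContinuousLinearMap.comp_smul]; exact (hT K hK).1.smul c
    · rw [ContinuousLinearMap.smul_comp]; exact (hT K hK).2.smul c
  mul_mem' := by
    rintro S T ⟨hS, hS'⟩ ⟨hT, hT'⟩
    refine ⟨fun K hK => ⟨?_, ?_⟩, hS'.mul h𝓔 hp hT'⟩
    · exact (hS K hK).1.comp_clm T
    · exact (hT K hK).2.clm_comp S

/-- The `L^p` Roe algebra `B^p(X)`, represented on `ℓ^p(Z × ℕ)`: the norm closure of the algebra of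
locally compact, controlled operators. -/
noncomputable def roeAlgebra {X : Type*} [TopologicalSpace X] (𝓔 : CoarseStructure X) (h𝓔 : 𝓔.IsProper)
    (Z : Set X) (p : ℝ≥0∞) [Fact (1 ≤ p)] (hp : p ≠ ∞) :
    NonUnitalSubalgebra ℂ (LpModule Z p →L[ℂ] LpModule Z p) :=
  (algebraicRoe 𝓔 h𝓔 Z p hp).topologicalClosure

instance nonUnitalSubalgebraNormedSpace {B : Type*} [NonUnitalNormedRing B] [NormedSpace ℂ B]
    (S : NonUnitalSubalgebra ℂ B) : NormedSpace ℂ S where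
  norm_smul_le c x := norm_smul_le c (x : B)

/-! ### `K₀` of a unital ring -/

/-- An idempotent matrix over `R`, of some finite size. -/
structure IdemMatrix (R : Type*) [Ring R] where
  /-- The size of the matrix. -/
  size : ℕ
  /-- The matrix. -/
  mat : Matrix (Fin size) (Fin size) R
  idem : mat * mat = mat

/-- Equivalence of two square matrices `e`, `f` (of possibly different sizes): `e = x y` and
`f = y x` for some rectangular matrices `x`, `y`. -/
def MatEquiv {R ι κ : Type*} [Ring R] [Fintype ι] [Fintype κ]
    (e : Matrix ι ι R) (f : Matrix κ κ R) : Prop :=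
  ∃ (x : Matrix ι κ R) (y : Matrix κ ι R), x * y = e ∧ y * x = f

section MatEquiv

variable {R ι κ μ ν : Type*} [Ring R] [Fintype ι] [Fintype κ] [Fintype μ] [Fintype ν]

theorem MatEquiv.symm {e : Matrix ι ι R} {f : Matrix κ κ R} (h : MatEquiv e f) :
    MatEquiv f e := by
  obtain ⟨x, y, h1, h2⟩ := h
  exact ⟨y, x, h2, h1⟩

theorem MatEquiv.trans {e : Matrix ι ι R} {f : Matrix κ κ R} {g : Matrix μ μ R}
    (he : e * e = e) (hg : g * g = g) (h : MatEquiv e f) (h' : MatEquiv f g) : MatEquiv e g := by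
  obtain ⟨x, y, h1, h2⟩ := h
  obtain ⟨z, w, h3, h4⟩ := h'
  refine ⟨x * z, w * y, ?_, ?_⟩
  · calc x * z * (w * y) = x * (z * w) * y := by simp only [Matrix.mul_assoc]
      _ = (x * y) * (x * y) := by rw [h3, ← h2]; simp only [Matrix.mul_assoc]
      _ = e := by rw [h1, he]
  · calc w * y * (x * z) = w * (y * x) * z := by simp only [Matrix.mul_assoc]
      _ = (w * z) * (w * z) := by rw [h2, ← h3]; simp only [Matrix.mul_assoc]
      _ = g := by rw [h4, hg]

theorem MatEquiv.submatrix {e : Matrix ι ι R} (he : e * e = e) (σ : κ ≃ ι) :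
    MatEquiv e (e.submatrix σ σ) := by
  refine ⟨e.submatrix id σ, e.submatrix σ id, ?_, ?_⟩
  · rw [Matrix.submatrix_mul_equiv, he, Matrix.submatrix_id_id]
  · rw [← Matrix.submatrix_mul _ _ _ id _ Function.bijective_id, he]

theorem MatEquiv.fromBlocks {e : Matrix ι ι R} {f : Matrix κ κ R} {e' : Matrix μ μ R}
    {f' : Matrix ν ν R} (h : MatEquiv e f) (h' : MatEquiv e' f') :
    MatEquiv (Matrix.fromBlocks e 0 0 e') (Matrix.fromBlocks f 0 0 f') := by
  obtain ⟨x, y, h1, h2⟩ := h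
  obtain ⟨z, w, h3, h4⟩ := h'
  refine ⟨Matrix.fromBlocks x 0 0 z, Matrix.fromBlocks y 0 0 w, ?_, ?_⟩ <;>
    simp [Matrix.fromBlocks_multiply, h1, h2, h3, h4]

theorem fromBlocks_idem {e : Matrix ι ι R} {f : Matrix κ κ R} (he : e * e = e) (hf : f * f = f) :
    Matrix.fromBlocks e 0 0 f * Matrix.fromBlocks e 0 0 f = Matrix.fromBlocks e 0 0 f := by
  simp [Matrix.fromBlocks_multiply, he, hf]

theorem submatrix_idem {e : Matrix ι ι R} (he : e * e = e) (σ : κ ≃ ι) :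
    e.submatrix σ σ * e.submatrix σ σ = e.submatrix σ σ := by
  rw [Matrix.submatrix_mul_equiv, he]

end MatEquiv

namespace IdemMatrix

variable {R : Type*} [Ring R]

instance setoid (R : Type*) [Ring R] : Setoid (IdemMatrix R) where
  r e f := MatEquiv e.mat f.mat
  iseqv :=
    { refl := fun e => ⟨e.mat, e.mat, e.idem, e.idem⟩
      symm := fun h => h.symm
      trans := fun {e _ g} h h' => h.trans e.idem g.idem h' }

/-- The zero idempotent, of size `0`. -/
def zero (R : Type*) [Ring R] : IdemMatrix R := ⟨0, 0, by simp⟩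

/-- The block sum `diag(e, f)`. -/
def add (e f : IdemMatrix R) : IdemMatrix R where
  size := e.size + f.size
  mat := (Matrix.fromBlocks e.mat 0 0 f.mat).submatrix finSumFinEquiv.symm finSumFinEquiv.symm
  idem := submatrix_idem (fromBlocks_idem e.idem f.idem) _

theorem matEquiv_add (e f : IdemMatrix R) :
    MatEquiv (Matrix.fromBlocks e.mat 0 0 f.mat) (e.add f).mat :=
  MatEquiv.submatrix (fromBlocks_idem e.idem f.idem) _

theorem add_congr {e e' f f' : IdemMatrix R} (h : e ≈ e') (h' : f ≈ f') : e.add f ≈ e'.add f' :=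
  (matEquiv_add e f).symm.trans (e.add f).idem (e'.add f').idem
    ((MatEquiv.fromBlocks h h').trans (fromBlocks_idem e.idem f.idem) (e'.add f').idem
      (matEquiv_add e' f'))

theorem add_comm' (e f : IdemMatrix R) : e.add f ≈ f.add e := by
  have h : MatEquiv (Matrix.fromBlocks e.mat 0 0 f.mat) (Matrix.fromBlocks f.mat 0 0 e.mat) := by
    have := MatEquiv.submatrix (fromBlocks_idem e.idem f.idem) (Equiv.sumComm _ _)
    rwa [show (Matrix.fromBlocks e.mat 0 0 f.mat).submatrix (Equiv.sumComm _ _)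
      (Equiv.sumComm _ _) = Matrix.fromBlocks f.mat 0 0 e.mat from
        Matrix.fromBlocks_submatrix_sum_swap_sum_swap _ _ _ _] at this
  exact (matEquiv_add e f).symm.trans (e.add f).idem (f.add e).idem
    (h.trans (fromBlocks_idem e.idem f.idem) (f.add e).idem (matEquiv_add f e))

theorem zero_add' (e : IdemMatrix R) : (zero R).add e ≈ e := by
  have h : MatEquiv (Matrix.fromBlocks (zero R).mat 0 0 e.mat) e.mat := by
    refine ⟨Matrix.fromRows 0 e.mat, Matrix.fromCols 0 e.mat, ?_, ?_⟩
    · rw [Matrix.fromRows_mul_fromCols]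
      have h0 : ∀ M : Matrix (Fin (zero R).size) (Fin (zero R).size) R, M = 0 := fun M => by
        ext i; exact i.elim0
      rw [h0 (zero R).mat, Matrix.zero_mul, Matrix.zero_mul, Matrix.mul_zero, e.idem]
    · rw [Matrix.fromCols_mul_fromRows]
      simp [e.idem]
  exact (matEquiv_add _ e).symm.trans ((zero R).add e).idem e.idem h

theorem add_assoc' (e f g : IdemMatrix R) : (e.add f).add g ≈ e.add (f.add g) := by
  have hg : MatEquiv g.mat g.mat := ⟨g.mat, g.mat, g.idem, g.idem⟩
  have he : MatEquiv e.mat e.mat := ⟨e.mat, e.mat, e.idem, e.idem⟩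
  have i1 := fromBlocks_idem (fromBlocks_idem e.idem f.idem) g.idem
  have i2 := fromBlocks_idem e.idem (fromBlocks_idem f.idem g.idem)
  have h1 : MatEquiv ((e.add f).add g).mat
      (Matrix.fromBlocks (Matrix.fromBlocks e.mat 0 0 f.mat) 0 0 g.mat) :=
    (matEquiv_add (e.add f) g).symm.trans ((e.add f).add g).idem i1
      (MatEquiv.fromBlocks (matEquiv_add e f).symm hg)
  have h2 : MatEquiv (Matrix.fromBlocks e.mat 0 0 (Matrix.fromBlocks f.mat 0 0 g.mat))
      (e.add (f.add g)).mat :=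
    (MatEquiv.fromBlocks he (matEquiv_add f g)).trans i2 (e.add (f.add g)).idem
      (matEquiv_add e (f.add g))
  have h3 : MatEquiv (Matrix.fromBlocks (Matrix.fromBlocks e.mat 0 0 f.mat) 0 0 g.mat)
      (Matrix.fromBlocks e.mat 0 0 (Matrix.fromBlocks f.mat 0 0 g.mat)) := by
    have := MatEquiv.submatrix i1 (Equiv.sumAssoc _ _ _).symm
    convert this using 1
    ext (i | i | i) (j | j | j) <;> simp
  exact h1.trans ((e.add f).add g).idem (e.add (f.add g)).idem
    (h3.trans i1 (e.add (f.add g)).idem h2)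

/-- Entrywise image of an idempotent matrix under a ring homomorphism. -/
def map {S : Type*} [Ring S] (φ : R →+* S) (e : IdemMatrix R) : IdemMatrix S where
  size := e.size
  mat := e.mat.map φ
  idem := by rw [← Matrix.map_mul, e.idem]

theorem map_congr {S : Type*} [Ring S] (φ : R →+* S) {e f : IdemMatrix R} (h : e ≈ f) :
    e.map φ ≈ f.map φ := by
  obtain ⟨x, y, h1, h2⟩ := h
  refine ⟨x.map φ, y.map φ, ?_, ?_⟩
  · exact (Matrix.map_mul (f := φ)).symm.trans (congrArg (fun M => M.map φ) h1)
  · exact (Matrix.map_mul (f := φ)).symm.trans (congrArg (fun M => M.map φ) h2)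

theorem map_add' {S : Type*} [Ring S] (φ : R →+* S) (e f : IdemMatrix R) :
    (e.add f).map φ ≈ (e.map φ).add (f.map φ) := by
  have : (e.add f).map φ = (e.map φ).add (f.map φ) := by
    have key : ((Matrix.fromBlocks e.mat 0 0 f.mat).submatrix finSumFinEquiv.symm
        finSumFinEquiv.symm).map φ = (Matrix.fromBlocks (e.mat.map φ) 0 0 (f.mat.map φ)).submatrix
          finSumFinEquiv.symm finSumFinEquiv.symm := by
      rw [← Matrix.submatrix_map, Matrix.fromBlocks_map]
      simp
    simp only [map, add, IdemMatrix.mk.injEq, heq_eq_eq, true_and]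
    exact key
  rw [this]

end IdemMatrix

/-- The monoid `V(R)` of equivalence classes of idempotent matrices over `R`, with block sum. -/
def IdemClass (R : Type*) [Ring R] : Type _ := Quotient (IdemMatrix.setoid R)

namespace IdemClass

instance (R : Type*) [Ring R] : Zero (IdemClass R) := ⟨Quotient.mk _ (IdemMatrix.zero R)⟩

instance (R : Type*) [Ring R] : Add (IdemClass R) :=
  ⟨Quotient.map₂ IdemMatrix.add fun _ _ h _ _ h' => IdemMatrix.add_congr h h'⟩

instance (R : Type*) [Ring R] : AddCommMonoid (IdemClass R) where
  add_assoc := by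
    rintro ⟨e⟩ ⟨f⟩ ⟨g⟩
    exact Quotient.sound (IdemMatrix.add_assoc' e f g)
  zero_add := by
    rintro ⟨e⟩
    exact Quotient.sound (IdemMatrix.zero_add' e)
  add_zero := by
    rintro ⟨e⟩
    exact Quotient.sound
      (Setoid.trans (IdemMatrix.add_comm' e (IdemMatrix.zero R)) (IdemMatrix.zero_add' e))
  add_comm := by
    rintro ⟨e⟩ ⟨f⟩
    exact Quotient.sound (IdemMatrix.add_comm' e f)
  nsmul := nsmulRec

/-- The map `V(R) → V(S)` induced by a ring homomorphism. -/
def map {R S : Type*} [Ring R] [Ring S] (φ : R →+* S) : IdemClass R →+ IdemClass S where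
  toFun := Quotient.map (IdemMatrix.map φ) fun _ _ h => IdemMatrix.map_congr φ h
  map_zero' := by
    refine Quotient.sound ⟨0, 0, ?_, ?_⟩ <;> ext i <;> exact i.elim0
  map_add' := by
    rintro ⟨e⟩ ⟨f⟩
    exact Quotient.sound (IdemMatrix.map_add' φ e f)

end IdemClass

/-- `K₀` of a unital ring: the Grothendieck group of `V(R)`. -/
abbrev UnitalK0 (R : Type*) [Ring R] : Type _ := Algebra.GrothendieckAddGroup (IdemClass R)

/-- The map on `K₀` induced by a unital ring homomorphism. -/
noncomputable def UnitalK0.map {R S : Type*} [Ring R] [Ring S] (φ : R →+* S) :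
    UnitalK0 R →+ UnitalK0 S :=
  Algebra.GrothendieckAddGroup.lift (Algebra.GrothendieckAddGroup.of.comp (IdemClass.map φ))

/-! ### `K₀` and `K₁` of a (not necessarily unital) complex Banach algebra -/

section BanachAlgebra

variable (A : Type*) [NonUnitalNormedRing A] [NormedSpace ℂ A] [IsScalarTower ℂ A A]
  [SMulCommClass ℂ A A]

/-- The unitization `A⁺ = ℂ ⊕ A` with a unit adjoined, with the norm `‖(c, a)‖ = |c| + ‖a‖`. -/
abbrev Unitized : Type _ := WithLp 1 (Unitization ℂ A)

/-- The canonical homomorphism `A⁺ → ℂ` with kernel `A`. -/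
noncomputable def augmentation : Unitized A →+* ℂ :=
  ((Unitization.fstHom ℂ A).comp
    (WithLp.unitizationAlgEquiv (𝕜 := ℂ) (A := A) ℂ).toAlgHom).toRingHom

/-- `K₀(A)`: the kernel of `K₀(A⁺) → K₀(ℂ)`. -/
noncomputable abbrev BanachK0 : Type _ := (UnitalK0.map (augmentation A)).ker

/-- `GL_n(A)`: the group of invertible `n × n` matrices over `A⁺` that are congruent to the
identity matrix modulo `A`. It carries the subspace topology of the unit group. -/
noncomputable abbrev GLn (n : ℕ) : Subgroup (Matrix (Fin n) (Fin n) (Unitized A))ˣ :=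
  (Units.map ((augmentation A).mapMatrix (m := Fin n)).toMonoidHom).ker

end BanachAlgebra

/-- The stabilization `M ↦ diag(M, 1)` from `n × n` to `m × m` matrices, `n ≤ m`. -/
def stabMatrix {R : Type*} [Ring R] {n m : ℕ} (h : n ≤ m) :
    Matrix (Fin n) (Fin n) R →* Matrix (Fin m) (Fin m) R where
  toFun M := Matrix.of fun i j =>
    if hi : (i : ℕ) < n then
      if hj : (j : ℕ) < n then M ⟨i, hi⟩ ⟨j, hj⟩ else 0
    else if i = j then 1 else 0
  map_one' := by
    ext i j
    simp only [Matrix.of_apply, Matrix.one_apply, Fin.ext_iff]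
    split_ifs <;> first | rfl | omega
  map_mul' M N := by
    obtain ⟨k, rfl⟩ := Nat.exists_eq_add_of_le h
    have hne : ∀ (a : Fin n) (b : Fin k), Fin.natAdd n b ≠ Fin.castAdd k a := fun a b hab => by
      have := congrArg Fin.val hab
      simp only [Fin.val_natAdd, Fin.val_castAdd] at this
      omega
    ext i j
    rw [Matrix.mul_apply, Fin.sum_univ_add]
    refine Fin.addCases (fun i => ?_) (fun i => ?_) i <;>
      refine Fin.addCases (fun j => ?_) (fun j => ?_) j <;>
      simp [Matrix.mul_apply, hne]

theorem stabMatrix_stabMatrix {R : Type*} [Ring R] {n m k : ℕ} (h : n ≤ m) (h' : m ≤ k)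
    (M : Matrix (Fin n) (Fin n) R) :
    stabMatrix h' (stabMatrix h M) = stabMatrix (h.trans h') M := by
  ext i j
  simp only [stabMatrix, MonoidHom.coe_mk, OneHom.coe_mk, Matrix.of_apply, Fin.ext_iff]
  split_ifs <;> first | rfl | omega

theorem continuous_stabMatrix {R : Type*} [Ring R] [TopologicalSpace R] {n m : ℕ} (h : n ≤ m) :
    Continuous (stabMatrix (R := R) h) := by
  refine continuous_matrix fun i j => ?_
  simp only [stabMatrix, MonoidHom.coe_mk, OneHom.coe_mk, Matrix.of_apply]
  split_ifs <;> fun_prop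

theorem map_stabMatrix {R S : Type*} [Ring R] [Ring S] (φ : R →+* S) {n m : ℕ} (h : n ≤ m)
    (M : Matrix (Fin n) (Fin n) R) :
    φ.mapMatrix (stabMatrix h M) = stabMatrix h (φ.mapMatrix M) := by
  ext i j
  simp only [stabMatrix, RingHom.mapMatrix_apply, Matrix.map_apply, MonoidHom.coe_mk,
    OneHom.coe_mk, Matrix.of_apply]
  split_ifs <;> simp

/-- The subgroup of a topological group given by the connected component of the identity is
normal. -/
instance connectedComponentOfOne_normal (G : Type*) [TopologicalSpace G] [Group G]
    [IsTopologicalGroup G] : (Subgroup.connectedComponentOfOne G).Normal where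
  conj_mem x hx g := by
    have hc : Continuous fun y : G => g * y * g⁻¹ := by fun_prop
    have := hc.image_connectedComponent_subset 1 ⟨x, hx, rfl⟩
    rw [show g * 1 * g⁻¹ = 1 by group] at this
    exact this

section K1

variable (A : Type*) [NonUnitalNormedRing A] [NormedSpace ℂ A] [IsScalarTower ℂ A A]
  [SMulCommClass ℂ A A]

/-- The stabilization `u ↦ diag(u, 1)` from `GL_n(A)` to `GL_m(A)`, `n ≤ m`. -/
noncomputable def stabGL {n m : ℕ} (h : n ≤ m) : GLn A n →* GLn A m :=
  ((Units.map (stabMatrix h)).comp (GLn A n).subtype).codRestrict (GLn A m) fun u => by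
    have hu := u.2
    have h1 : (augmentation A).mapMatrix
        ((u : (Matrix (Fin n) (Fin n) (Unitized A))ˣ) : Matrix (Fin n) (Fin n) (Unitized A)) = 1 :=
      congrArg Units.val (MonoidHom.mem_ker.1 hu)
    refine MonoidHom.mem_ker.2 (Units.ext ?_)
    change (augmentation A).mapMatrix (stabMatrix h _) = 1
    rw [map_stabMatrix]
    exact (congrArg (stabMatrix h) h1).trans (map_one _)

theorem continuous_stabGL {n m : ℕ} (h : n ≤ m) : Continuous (stabGL A h) :=
  continuous_induced_rng.2 <|
    (Continuous.units_map (stabMatrix (R := Unitized A) h) (continuous_stabMatrix h)).comp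
      continuous_subtype_val

/-- `π₀(GL_n(A)) = GL_n(A) / GL_n(A)₀`, with `GL_n(A)₀` the connected component of the identity. -/
noncomputable abbrev PiZeroGL (n : ℕ) : Type _ :=
  GLn A n ⧸ Subgroup.connectedComponentOfOne (GLn A n)

/-- The map `π₀(GL_n(A)) → π₀(GL_m(A))` induced by stabilization. -/
noncomputable def piZeroStab (n m : ℕ) (h : n ≤ m) : PiZeroGL A n →* PiZeroGL A m :=
  QuotientGroup.map _ _ (stabGL A h) fun u hu => by
    have := (continuous_stabGL A h).image_connectedComponent_subset 1 ⟨u, hu, rfl⟩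
    rw [map_one] at this
    exact this

instance piZeroStab_directedSystem :
    DirectedSystem (PiZeroGL A) (fun n m h => piZeroStab A n m h) where
  map_self n x := by
    induction x using QuotientGroup.induction_on with
    | H u =>
      refine congrArg (QuotientGroup.mk) (Subtype.ext (Units.ext ?_))
      ext i j
      simp [stabGL, stabMatrix]
  map_map _ _ _ h h' x := by
    induction x using QuotientGroup.induction_on with
    | H u =>
      refine congrArg (QuotientGroup.mk) (Subtype.ext (Units.ext ?_))
      exact stabMatrix_stabMatrix h h'
        (u : (Matrix (Fin _) (Fin _) (Unitized A))ˣ).val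

/-- `K₁(A)`: the direct limit of the groups `π₀(GL_n(A))` under stabilization. It is a group, by
the general group structure on direct limits of groups. -/
noncomputable abbrev BanachK1 : Type _ := DirectLimit (PiZeroGL A) (piZeroStab A)

end K1

/-! ### Operators on `ℓ^p` induced by injections -/

section LpOperators

variable {ι κ : Type*} {p : ℝ≥0∞} [Fact (1 ≤ p)]

/-! The proof builds an endomorphism `φ` of the Roe algebra `A`, an infinite repetition `φ T = ∑ₖ Vₖ
T Vₖ⁻¹`, with `id + φ = φ` on K-theory. Then `id = 0` there, so the K-groups vanish.

The operators `Vₖ` extend functions by zero along injections `τ (k, ·)` of `Z × ℕ` with disjoint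
ranges, where `τ (k, ·)` is close to `α k` (`exists_injective_close`). The factor `ℕ` leaves room
for this even though `α k` need not be injective. Disjointness gives `‖φ T‖ ≤ ‖T‖` and
multiplicativity. By `lpSwindle_mem_algebraicRoe`, `φ` preserves locally compact controlled
operators. Over a bounded set only finitely many copies are seen, by proper support, and each is
compact there because `α k` is proper. Uniform control of the `α k` bounds the propagation of all
copies at once.

Let `v = V₀` and let `w` be induced by the shift `τ (k, a) ↦ τ (k + 1, a)`. As `α 0 = id` and
consecutive maps are uniformly close, both are controlled, as are their left inverses, so all four
are multipliers of `A`. Their ranges are complementary, and renumbering the copies gives `φ a = v a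
vInv + w (φ a) wInv` (`lpSwindle_eq`).

Thus an involution in the 3 × 3 matrices over the multipliers conjugates `diag(a, φ a, 0)` to
`diag(0, 0, φ a)`. Conjugation by an involution is homotopic to the identity
(`augHomotopic_of_involution`), so after unitization the two homomorphisms agree on `K₀`, by
`MatEquiv.of_continuous`, and on `π₀` of the general linear groups, by `AugHomotopic.inv_mul_mem`.
Cancelling `φ` shows that an idempotent has the class of its scalar part, and that `diag(u, 1, 1)`
lies in the identity component. -/

theorem toReal_pos_of_one_le (hp : p ≠ ∞) : 0 < p.toReal :=
  ENNReal.toReal_pos (zero_lt_one.trans_le Fact.out).ne' hp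

/-- An operator between `ℓ^p`-spaces from a linear map to functions with a uniform bound on
the finite partial sums of `p`-th powers. -/
noncomputable def lpOperator (hp : p ≠ ∞)
    (F : lp (fun _ : ι => ℂ) p →ₗ[ℂ] (κ → ℂ)) (C : ℝ) (hC : 0 ≤ C)
    (h : ∀ ξ (s : Finset κ), ∑ b ∈ s, ‖F ξ b‖ ^ p.toReal ≤ (C * ‖ξ‖) ^ p.toReal) :
    lp (fun _ : ι => ℂ) p →L[ℂ] lp (fun _ : κ => ℂ) p :=
  LinearMap.mkContinuous
    { toFun := fun ξ => ⟨F ξ, memℓp_gen' (h ξ)⟩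
      map_add' := fun ξ η => lp.ext (map_add F ξ η)
      map_smul' := fun c ξ => lp.ext (map_smul F c ξ) }
    C fun ξ => lp.norm_le_of_forall_sum_le (toReal_pos_of_one_le hp)
      (mul_nonneg hC (norm_nonneg ξ)) (h ξ)

theorem norm_lpOperator_le (hp : p ≠ ∞)
    (F : lp (fun _ : ι => ℂ) p →ₗ[ℂ] (κ → ℂ)) (C : ℝ) (hC : 0 ≤ C)
    (h : ∀ ξ (s : Finset κ), ∑ b ∈ s, ‖F ξ b‖ ^ p.toReal ≤ (C * ‖ξ‖) ^ p.toReal) :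
    ‖lpOperator hp F C hC h‖ ≤ C :=
  LinearMap.mkContinuous_norm_le _ hC fun ξ => lp.norm_le_of_forall_sum_le
    (toReal_pos_of_one_le hp) (mul_nonneg hC (norm_nonneg ξ)) (h ξ)

/-- Restriction of functions along an injection. -/
noncomputable def lpRes (hp : p ≠ ∞) (σ : ι → κ) (hσ : Function.Injective σ) :
    lp (fun _ : κ => ℂ) p →L[ℂ] lp (fun _ : ι => ℂ) p :=
  lpOperator hp
    { toFun := fun ξ a => (ξ : κ → ℂ) (σ a)
      map_add' := fun _ _ => rfl
      map_smul' := fun _ _ => rfl } 1 zero_le_one fun ξ s => by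
      rw [one_mul]
      refine le_trans (le_of_eq ?_)
        (lp.sum_rpow_le_norm_rpow (toReal_pos_of_one_le hp) ξ (s.map ⟨σ, hσ⟩))
      rw [Finset.sum_map]
      rfl

theorem lpRes_apply (hp : p ≠ ∞) (σ : ι → κ) (hσ : Function.Injective σ)
    (ξ : lp (fun _ : κ => ℂ) p) (a : ι) :
    (lpRes hp σ hσ ξ : ι → ℂ) a = (ξ : κ → ℂ) (σ a) := rfl

/-- Extension of functions by zero along an injection. -/
noncomputable def lpExt (hp : p ≠ ∞) (σ : ι → κ) (hσ : Function.Injective σ) :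
    lp (fun _ : ι => ℂ) p →L[ℂ] lp (fun _ : κ => ℂ) p :=
  lpOperator hp
    { toFun := fun ξ => Function.extend σ (ξ : ι → ℂ) 0
      map_add' := fun ξ η => by
        have := Function.extend_add σ (ξ : ι → ℂ) (η : ι → ℂ) 0 0
        rw [add_zero] at this
        exact this
      map_smul' := fun c ξ => by
        have := Function.extend_smul c σ (ξ : ι → ℂ) 0
        rw [smul_zero] at this
        exact this } 1 zero_le_one fun ξ s => by
      classical
      rw [one_mul]
      have hp0 := toReal_pos_of_one_le hp
      refine le_trans (le_of_eq ?_)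
        (lp.sum_rpow_le_norm_rpow hp0 ξ (s.preimage σ hσ.injOn))
      have := Finset.sum_preimage σ s hσ.injOn
        (fun b => ‖Function.extend σ (ξ : ι → ℂ) 0 b‖ ^ p.toReal) (fun b _ hb => by
          rw [Function.extend_apply' _ _ _ hb]
          simp [Real.zero_rpow hp0.ne'])
      simp only [hσ.extend_apply] at this
      exact this.symm

theorem lpExt_apply (hp : p ≠ ∞) (σ : ι → κ) (hσ : Function.Injective σ)
    (ξ : lp (fun _ : ι => ℂ) p) (a : ι) :
    (lpExt hp σ hσ ξ : κ → ℂ) (σ a) = (ξ : ι → ℂ) a := hσ.extend_apply _ _ _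

theorem lpExt_apply_of_notMem (hp : p ≠ ∞) (σ : ι → κ) (hσ : Function.Injective σ)
    (ξ : lp (fun _ : ι => ℂ) p) {b : κ} (hb : b ∉ range σ) :
    (lpExt hp σ hσ ξ : κ → ℂ) b = 0 := Function.extend_apply' _ _ _ hb

theorem lpRes_lpExt (hp : p ≠ ∞) (σ : ι → κ) (hσ : Function.Injective σ)
    (ξ : lp (fun _ : ι => ℂ) p) : lpRes hp σ hσ (lpExt hp σ hσ ξ) = ξ := by
  ext a
  rw [lpRes_apply, lpExt_apply]

theorem lpRes_lpExt_of_disjoint {μ : Type*} (hp : p ≠ ∞) (σ : ι → κ) (hσ : Function.Injective σ)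
    (τ : μ → κ) (hτ : Function.Injective τ) (h : ∀ a b, σ a ≠ τ b)
    (ξ : lp (fun _ : ι => ℂ) p) : lpRes hp τ hτ (lpExt hp σ hσ ξ) = 0 := by
  ext a
  rw [lpRes_apply, lpExt_apply_of_notMem]
  · rfl
  · rintro ⟨b, hb⟩
    exact h b a hb

/-- Each slice norm is a limit of sums over finite sets `t`, and for finite `s` and `t` the double
sum is a partial sum over the rectangle `s ×ˢ t`. -/
theorem sum_norm_slice_le (hp : p ≠ ∞) (ξ : lp (fun _ : κ × ι => ℂ) p) (s : Finset κ) :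
    ∑ k ∈ s, ‖lpRes hp (fun a : ι => (k, a)) (Prod.mk_right_injective k) ξ‖ ^ p.toReal
      ≤ ‖ξ‖ ^ p.toReal := by
  have hp0 := toReal_pos_of_one_le hp
  have h1 := hasSum_sum (s := s) fun k _ =>
    lp.hasSum_norm hp0 (lpRes hp (fun a : ι => (k, a)) (Prod.mk_right_injective k) ξ)
  refine hasSum_le_of_sum_le h1 fun t => ?_
  rw [Finset.sum_comm]
  refine le_trans (le_of_eq ?_) (lp.sum_rpow_le_norm_rpow hp0 ξ (s ×ˢ t))
  rw [Finset.sum_product]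
  rfl

/-- The amplification `1 ⊗ T` acting on `ℓ^p(κ × ι)`. -/
noncomputable def lpAmplify (hp : p ≠ ∞) (κ : Type*)
    (T : lp (fun _ : ι => ℂ) p →L[ℂ] lp (fun _ : ι => ℂ) p) :
    lp (fun _ : κ × ι => ℂ) p →L[ℂ] lp (fun _ : κ × ι => ℂ) p :=
  lpOperator hp
    { toFun := fun ξ b =>
        (T (lpRes hp (fun a : ι => (b.1, a)) (Prod.mk_right_injective b.1) ξ) : ι → ℂ) b.2
      map_add' := fun ξ η => by ext b; simp only [map_add]; rfl
      map_smul' := fun c ξ => by ext b; simp only [map_smul]; rfl } ‖T‖ (norm_nonneg T)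
    fun ξ s => by
      classical
      have hp0 := toReal_pos_of_one_le hp
      rw [Real.mul_rpow (norm_nonneg _) (norm_nonneg _)]
      refine le_trans ?_ (mul_le_mul_of_nonneg_left (sum_norm_slice_le hp ξ (s.image Prod.fst))
        (by positivity))
      rw [Finset.mul_sum]
      -- The finite set of pairs is enlarged to the product of its projections, so that the sum
      -- splits into slices on which the bound for `T` applies.
      refine le_trans (Finset.sum_le_sum_of_subset_of_nonneg
        (Finset.subset_product (s := s)) fun _ _ _ => by positivity) ?_
      rw [Finset.sum_product]
      refine Finset.sum_le_sum fun k _ => ?_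
      rw [← Real.mul_rpow (norm_nonneg _) (norm_nonneg _)]
      refine (lp.sum_rpow_le_norm_rpow hp0 (T (lpRes hp (fun a : ι => (k, a))
        (Prod.mk_right_injective k) ξ)) _).trans ?_
      exact Real.rpow_le_rpow (norm_nonneg _) (T.le_opNorm _) hp0.le

theorem lpAmplify_mul (hp : p ≠ ∞) (S T : lp (fun _ : ι => ℂ) p →L[ℂ] lp (fun _ : ι => ℂ) p) :
    lpAmplify hp κ (S * T) = lpAmplify hp κ S * lpAmplify hp κ T := by
  ext ξ ⟨k, a⟩
  rfl

theorem norm_lpRes_le (hp : p ≠ ∞) (σ : ι → κ) (hσ : Function.Injective σ) :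
    ‖lpRes (p := p) hp σ hσ‖ ≤ 1 :=
  norm_lpOperator_le ..

theorem norm_lpExt_le (hp : p ≠ ∞) (σ : ι → κ) (hσ : Function.Injective σ) :
    ‖lpExt (p := p) hp σ hσ‖ ≤ 1 :=
  norm_lpOperator_le ..

theorem norm_lpAmplify_le (hp : p ≠ ∞)
    (T : lp (fun _ : ι => ℂ) p →L[ℂ] lp (fun _ : ι => ℂ) p) : ‖lpAmplify hp κ T‖ ≤ ‖T‖ :=
  norm_lpOperator_le ..

theorem injective_slice {τ : κ × ι → ι} (hτ : Function.Injective τ) (k : κ) :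
    Function.Injective fun a => τ (k, a) := hτ.comp (Prod.mk_right_injective k)

/-- The infinite sum of copies of an operator along the disjoint injections `τ (k, ·)`. -/
noncomputable def lpSwindle (hp : p ≠ ∞) (τ : κ × ι → ι) (hτ : Function.Injective τ) :
    (lp (fun _ : ι => ℂ) p →L[ℂ] lp (fun _ : ι => ℂ) p) →ₙₐ[ℂ]
      (lp (fun _ : ι => ℂ) p →L[ℂ] lp (fun _ : ι => ℂ) p) where
  toFun T := lpExt hp τ hτ ∘L lpAmplify hp κ T ∘L lpRes hp τ hτ
  map_smul' c T := by
    have h : lpAmplify hp κ (c • T) = c • lpAmplify hp κ T := by ext ξ ⟨k, a⟩; rfl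
    rw [h, ContinuousLinearMap.smul_comp, ContinuousLinearMap.comp_smul]
    rfl
  map_zero' := by
    have h : lpAmplify hp κ (0 : lp (fun _ : ι => ℂ) p →L[ℂ] _) = 0 := by ext ξ ⟨k, a⟩; rfl
    rw [h, ContinuousLinearMap.zero_comp, ContinuousLinearMap.comp_zero]
  map_add' S T := by
    have h : lpAmplify hp κ (S + T) = lpAmplify hp κ S + lpAmplify hp κ T := by
      ext ξ ⟨k, a⟩; rfl
    rw [h, ContinuousLinearMap.add_comp, ContinuousLinearMap.comp_add]
  map_mul' S T := by
    rw [lpAmplify_mul]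
    ext1 ξ
    simp only [mul_apply_eq_comp, ContinuousLinearMap.comp_apply, lpRes_lpExt]

theorem lpSwindle_apply (hp : p ≠ ∞) (τ : κ × ι → ι) (hτ : Function.Injective τ)
    (T : lp (fun _ : ι => ℂ) p →L[ℂ] lp (fun _ : ι => ℂ) p) (ξ : lp (fun _ : ι => ℂ) p)
    (k : κ) (a : ι) :
    (lpSwindle hp τ hτ T ξ : ι → ℂ) (τ (k, a))
      = (T (lpRes hp (fun a => τ (k, a)) (injective_slice hτ k) ξ) : ι → ℂ) a :=
  hτ.extend_apply _ _ _

theorem lpSwindle_apply_of_notMem (hp : p ≠ ∞) (τ : κ × ι → ι) (hτ : Function.Injective τ)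
    (T : lp (fun _ : ι => ℂ) p →L[ℂ] lp (fun _ : ι => ℂ) p) (ξ : lp (fun _ : ι => ℂ) p)
    {b : ι} (hb : b ∉ range τ) : (lpSwindle hp τ hτ T ξ : ι → ℂ) b = 0 :=
  Function.extend_apply' _ _ _ hb

theorem norm_lpSwindle_le (hp : p ≠ ∞) (τ : κ × ι → ι) (hτ : Function.Injective τ)
    (T : lp (fun _ : ι => ℂ) p →L[ℂ] lp (fun _ : ι => ℂ) p) : ‖lpSwindle hp τ hτ T‖ ≤ ‖T‖ := by
  have h := norm_lpAmplify_le (κ := κ) hp T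
  calc ‖lpSwindle hp τ hτ T‖
      ≤ ‖lpExt hp τ hτ‖ * (‖lpAmplify hp κ T‖ * ‖lpRes hp τ hτ‖) :=
        (ContinuousLinearMap.opNorm_comp_le _ _).trans
          (mul_le_mul_of_nonneg_left (ContinuousLinearMap.opNorm_comp_le _ _) (norm_nonneg _))
    _ ≤ 1 * (‖T‖ * 1) := by
        gcongr
        · exact norm_lpExt_le hp τ hτ
        · exact norm_lpRes_le hp τ hτ
    _ = ‖T‖ := by ring

/-! ### The shift of the copies and the absorption identity -/

/-- The shift `τ (k, a) ↦ τ (k + 1, a)`, extended by the identity. -/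
noncomputable def shiftMap (τ : ℕ × ι → ι) : ι → ι :=
  Function.extend τ (fun q => τ (q.1 + 1, q.2)) id

theorem shiftMap_apply {τ : ℕ × ι → ι} (hτ : Function.Injective τ) (k : ℕ) (a : ι) :
    shiftMap τ (τ (k, a)) = τ (k + 1, a) := hτ.extend_apply _ _ _

theorem shiftMap_of_notMem {τ : ℕ × ι → ι} {b : ι} (hb : b ∉ range τ) : shiftMap τ b = b :=
  Function.extend_apply' _ _ _ hb

theorem shiftMap_injective {τ : ℕ × ι → ι} (hτ : Function.Injective τ) :
    Function.Injective (shiftMap τ) := by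
  intro b c hbc
  by_cases hb : b ∈ range τ <;> by_cases hc : c ∈ range τ
  · obtain ⟨⟨k, a⟩, rfl⟩ := hb
    obtain ⟨⟨l, d⟩, rfl⟩ := hc
    rw [shiftMap_apply hτ, shiftMap_apply hτ] at hbc
    have := hτ hbc
    simp only [Prod.mk.injEq, add_left_inj] at this
    rw [this.1, this.2]
  · obtain ⟨⟨k, a⟩, rfl⟩ := hb
    rw [shiftMap_apply hτ, shiftMap_of_notMem hc] at hbc
    exact absurd ⟨_, hbc⟩ hc
  · obtain ⟨⟨k, a⟩, rfl⟩ := hc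
    rw [shiftMap_apply hτ, shiftMap_of_notMem hb] at hbc
    exact absurd ⟨_, hbc.symm⟩ hb
  · rwa [shiftMap_of_notMem hb, shiftMap_of_notMem hc] at hbc

theorem ne_shiftMap {τ : ℕ × ι → ι} (hτ : Function.Injective τ) (a b : ι) :
    τ (0, a) ≠ shiftMap τ b := by
  intro h
  by_cases hb : b ∈ range τ
  · obtain ⟨⟨k, c⟩, rfl⟩ := hb
    rw [shiftMap_apply hτ] at h
    have := congrArg Prod.fst (hτ h)
    simp at this
  · rw [shiftMap_of_notMem hb] at h
    exact hb ⟨_, h⟩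

/-- Copy `k + 1` is reached from copy `k`, and points in no copy are fixed. With `ne_shiftMap` this
partitions `ι` into the zeroth copy and the range of the shift, which makes `v` and `w`
complementary. -/
theorem mem_range_or_mem_range_shiftMap {τ : ℕ × ι → ι} (hτ : Function.Injective τ) (b : ι) :
    (∃ a, b = τ (0, a)) ∨ ∃ c, b = shiftMap τ c := by
  by_cases hb : b ∈ range τ
  · obtain ⟨⟨_ | k, c⟩, rfl⟩ := hb
    · exact Or.inl ⟨c, rfl⟩
    · exact Or.inr ⟨τ (k, c), (shiftMap_apply hτ k c).symm⟩
  · exact Or.inr ⟨b, (shiftMap_of_notMem hb).symm⟩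

theorem head_add_shift (hp : p ≠ ∞) {τ : ℕ × ι → ι} (hτ : Function.Injective τ)
    (ξ : lp (fun _ : ι => ℂ) p) :
    lpExt hp _ (injective_slice hτ 0) (lpRes hp _ (injective_slice hτ 0) ξ)
      + lpExt hp _ (shiftMap_injective hτ) (lpRes hp _ (shiftMap_injective hτ) ξ) = ξ := by
  ext b
  rw [lp.coeFn_add, Pi.add_apply]
  obtain ⟨a, rfl⟩ | ⟨c, rfl⟩ := mem_range_or_mem_range_shiftMap hτ b
  · rw [lpExt_apply hp _ (injective_slice hτ 0), lpExt_apply_of_notMem, lpRes_apply, add_zero]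
    rintro ⟨c, hc⟩
    exact ne_shiftMap hτ a c hc.symm
  · rw [lpExt_apply hp _ (shiftMap_injective hτ), lpExt_apply_of_notMem, lpRes_apply, zero_add]
    rintro ⟨a, ha⟩
    exact ne_shiftMap hτ a c ha

/-- Splitting off the zeroth copy and renumbering the others returns the same infinite repetition,
since the shift carries copy `k` onto copy `k + 1`. Off all copies both sides vanish, so it is
harmless that the shift is the identity there. -/
theorem lpSwindle_eq (hp : p ≠ ∞) {τ : ℕ × ι → ι} (hτ : Function.Injective τ)
    (T : lp (fun _ : ι => ℂ) p →L[ℂ] lp (fun _ : ι => ℂ) p) (ξ : lp (fun _ : ι => ℂ) p) :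
    lpExt hp _ (injective_slice hτ 0) (T (lpRes hp _ (injective_slice hτ 0) ξ))
      + lpExt hp _ (shiftMap_injective hτ)
        (lpSwindle hp τ hτ T (lpRes hp _ (shiftMap_injective hτ) ξ))
      = lpSwindle hp τ hτ T ξ := by
  ext b
  rw [lp.coeFn_add, Pi.add_apply]
  obtain ⟨a, rfl⟩ | ⟨c, rfl⟩ := mem_range_or_mem_range_shiftMap hτ b
  · rw [lpExt_apply hp _ (injective_slice hτ 0), lpExt_apply_of_notMem, add_zero, lpSwindle_apply]
    rintro ⟨c, hc⟩
    exact ne_shiftMap hτ a c hc.symm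
  · rw [lpExt_apply hp _ (shiftMap_injective hτ), lpExt_apply_of_notMem, zero_add]
    · by_cases hc : c ∈ range τ
      · obtain ⟨⟨k, a⟩, rfl⟩ := hc
        rw [shiftMap_apply hτ, lpSwindle_apply, lpSwindle_apply]
        refine congrArg (fun η : lp (fun _ : ι => ℂ) p => (T η : ι → ℂ) a) (lp.ext ?_)
        ext d
        simp only [lpRes_apply, shiftMap_apply hτ]
      · rw [shiftMap_of_notMem hc, lpSwindle_apply_of_notMem _ _ _ _ _ hc,
          lpSwindle_apply_of_notMem _ _ _ _ _ hc]
    · rintro ⟨a, ha⟩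
      exact ne_shiftMap hτ a c ha

end LpOperators

/-! ### Bounded sets -/

namespace CoarseStructure

variable {X : Type*} (𝓔 : CoarseStructure X)

theorem isBounded_singleton (x : X) : 𝓔.IsBounded {x} := by
  refine 𝓔.subset_mem 𝓔.diagonal_mem ?_
  rintro ⟨y, z⟩ ⟨hy, hz⟩
  exact (mem_singleton_iff.1 hy).trans (mem_singleton_iff.1 hz).symm

variable {𝓔}

theorem IsBounded.thicken {S : Set (X × X)} (hS : S ∈ 𝓔.controlled) {B : Set X}
    (hB : 𝓔.IsBounded B) : 𝓔.IsBounded {y | ∃ x ∈ B, (x, y) ∈ S} := by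
  refine 𝓔.subset_mem (𝓔.comp_mem (𝓔.inv_mem hS) (𝓔.comp_mem hB hS)) ?_
  rintro ⟨y, z⟩ ⟨⟨x, hx, hxy⟩, ⟨w, hw, hwz⟩⟩
  exact ⟨x, hxy, w, ⟨hx, hw⟩, hwz⟩

theorem IsBounded.thicken_inv {S : Set (X × X)} (hS : S ∈ 𝓔.controlled) {B : Set X}
    (hB : 𝓔.IsBounded B) : 𝓔.IsBounded {x | ∃ y ∈ B, (x, y) ∈ S} :=
  hB.thicken (𝓔.inv_mem hS)

end CoarseStructure

/-! ### Controlled and locally compact operators -/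

section Operators

variable {X : Type*} {Z : Set X} {p : ℝ≥0∞} [Fact (1 ≤ p)]

theorem chi_comp_chi_of_subset {A B : Set X} (h : A ⊆ B) :
    chi Z p A ∘L chi Z p B = chi Z p A := by
  classical
  ext ξ b
  simp only [ContinuousLinearMap.comp_apply, chi_apply, indicator_apply, mem_ofPred_eq]
  split_ifs with h1 h2
  · rfl
  · exact absurd (h h1) h2
  · rfl

theorem chi_comp_chi_of_subset' {A B : Set X} (h : A ⊆ B) :
    chi Z p B ∘L chi Z p A = chi Z p A := by
  classical
  ext ξ b
  simp only [ContinuousLinearMap.comp_apply, chi_apply, indicator_apply, mem_ofPred_eq]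
  split_ifs with h1 h2 h2
  · rfl
  · rfl
  · exact absurd (h h2) h1
  · rfl

theorem chi_union (A B : Set X) : chi Z p (A ∪ B) = chi Z p A + chi Z p (B \ A) := by
  classical
  ext ξ b
  rw [_root_.add_apply, lp.coeFn_add, Pi.add_apply]
  simp only [chi_apply, indicator_apply, mem_ofPred_eq, mem_union, mem_sdiff]
  split_ifs <;> first | tauto | simp

theorem chi_empty : chi Z p (∅ : Set X) = 0 := by
  ext ξ b
  simp [chi_apply]

/-- The entries of `T` in the columns over `B` lie over the set of points related to `B`. -/
theorem comp_chi_eq (hp : p ≠ ∞) {T : LpModule Z p →L[ℂ] LpModule Z p} {S : Set (X × X)}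
    (h : ∀ [DecidableEq (Z × ℕ)] (a b : Z × ℕ),
      (T (lp.single p a 1) : Z × ℕ → ℂ) b ≠ 0 → ((a.1 : X), (b.1 : X)) ∈ S) (B : Set X) :
    T ∘L chi Z p B = chi Z p {y | ∃ x ∈ B, (x, y) ∈ S} ∘L T ∘L chi Z p B := by
  classical
  refine lp.ext_continuousLinearMap hp fun a => ?_
  ext b
  simp only [ContinuousLinearMap.comp_apply, lp.singleContinuousLinearMap_apply]
  by_cases ha : (a.1 : X) ∈ B
  · rw [chi_single_of_mem ha, chi_apply, indicator_apply]
    split_ifs with hb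
    · rfl
    · by_contra hne
      exact hb ⟨a.1, ha, h a b hne⟩
  · rw [chi_single_of_notMem ha, map_zero, map_zero]

theorem chi_comp_eq (hp : p ≠ ∞) {T : LpModule Z p →L[ℂ] LpModule Z p} {S : Set (X × X)}
    (h : ∀ [DecidableEq (Z × ℕ)] (a b : Z × ℕ),
      (T (lp.single p a 1) : Z × ℕ → ℂ) b ≠ 0 → ((a.1 : X), (b.1 : X)) ∈ S) (B : Set X) :
    chi Z p B ∘L T = chi Z p B ∘L T ∘L chi Z p {x | ∃ y ∈ B, (x, y) ∈ S} := by
  classical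
  refine lp.ext_continuousLinearMap hp fun a => ?_
  ext b
  simp only [ContinuousLinearMap.comp_apply, lp.singleContinuousLinearMap_apply]
  by_cases ha : (a.1 : X) ∈ {x | ∃ y ∈ B, (x, y) ∈ S}
  · rw [chi_single_of_mem ha]
  · rw [chi_single_of_notMem ha, map_zero, map_zero, chi_apply, indicator_apply]
    split_ifs with hb
    · by_contra hne
      exact ha ⟨b.1, hb, h a b hne⟩
    · rfl

/-! ### Finite truncations of the infinite repetition -/

variable {τ : ℕ × (Z × ℕ) → Z × ℕ} (hτ : Function.Injective τ)

theorem sum_lpExt_lpRes_apply (hp : p ≠ ∞) (T : LpModule Z p →L[ℂ] LpModule Z p)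
    (F : Finset ℕ)
    (ξ : LpModule Z p) (k : ℕ) (c : Z × ℕ) :
    ((∑ l ∈ F, lpExt hp (fun a => τ (l, a)) (injective_slice hτ l) ∘L T ∘L
      lpRes hp (fun a => τ (l, a)) (injective_slice hτ l)) ξ : Z × ℕ → ℂ) (τ (k, c))
      = if k ∈ F then (lpSwindle hp τ hτ T ξ : Z × ℕ → ℂ) (τ (k, c)) else 0 := by
  rw [_root_.sum_apply, lp.coeFn_sum, Finset.sum_apply, ← Finset.sum_ite_eq' F k
    (fun _ => (lpSwindle hp τ hτ T ξ : Z × ℕ → ℂ) (τ (k, c)))]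
  refine Finset.sum_congr rfl fun l _ => ?_
  simp only [ContinuousLinearMap.comp_apply]
  split_ifs with h
  · subst h
    rw [lpSwindle_apply]
    exact lpExt_apply hp (fun a => τ (l, a)) _ _ c
  · refine lpExt_apply_of_notMem hp _ _ _ ?_
    rintro ⟨d, hd⟩
    exact h (congrArg Prod.fst (hτ hd))

theorem sum_lpExt_lpRes_apply_of_notMem (hp : p ≠ ∞) (T : LpModule Z p →L[ℂ] LpModule Z p)
    (F : Finset ℕ)
    (ξ : LpModule Z p) {b : Z × ℕ} (hb : b ∉ range τ) :
    ((∑ l ∈ F, lpExt hp (fun a => τ (l, a)) (injective_slice hτ l) ∘L T ∘L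
      lpRes hp (fun a => τ (l, a)) (injective_slice hτ l)) ξ : Z × ℕ → ℂ) b = 0 := by
  rw [_root_.sum_apply, lp.coeFn_sum, Finset.sum_apply]
  refine Finset.sum_eq_zero fun l _ => ?_
  refine lpExt_apply_of_notMem hp _ (injective_slice hτ l) _ ?_
  rintro ⟨d, rfl⟩
  exact hb ⟨_, rfl⟩

/-- Only the copies indexed by `F` have points over `B`, so the other copies contribute no rows
there. This reduces compactness of the cut-off repetition to finitely many terms. -/
theorem chi_comp_lpSwindle (hp : p ≠ ∞) (T : LpModule Z p →L[ℂ] LpModule Z p)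
    (B : Set X) (F : Finset ℕ)
    (hF : ∀ k a, ((τ (k, a)).1 : X) ∈ B → k ∈ F) :
    chi Z p B ∘L lpSwindle hp τ hτ T = chi Z p B ∘L ∑ l ∈ F,
      lpExt hp (fun a => τ (l, a)) (injective_slice hτ l) ∘L T ∘L
      lpRes hp (fun a => τ (l, a)) (injective_slice hτ l) := by
  classical
  ext ξ b
  simp only [ContinuousLinearMap.comp_apply, chi_apply, indicator_apply, mem_ofPred_eq]
  split_ifs with hB
  · by_cases hb : b ∈ range τ
    · obtain ⟨⟨k, c⟩, rfl⟩ := hb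
      rw [sum_lpExt_lpRes_apply, if_pos (hF k c hB)]
    · rw [sum_lpExt_lpRes_apply_of_notMem hτ hp T F ξ hb, lpSwindle_apply_of_notMem hp τ hτ T ξ hb]
  · rfl

theorem lpSwindle_comp_chi (hp : p ≠ ∞) (T : LpModule Z p →L[ℂ] LpModule Z p)
    (B : Set X) (F : Finset ℕ)
    (hF : ∀ k a, ((τ (k, a)).1 : X) ∈ B → k ∈ F) :
    lpSwindle hp τ hτ T ∘L chi Z p B = (∑ l ∈ F,
      lpExt hp (fun a => τ (l, a)) (injective_slice hτ l) ∘L T ∘L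
      lpRes hp (fun a => τ (l, a)) (injective_slice hτ l)) ∘L chi Z p B := by
  classical
  ext ξ b
  simp only [ContinuousLinearMap.comp_apply]
  by_cases hb : b ∈ range τ
  · obtain ⟨⟨k, c⟩, rfl⟩ := hb
    rw [sum_lpExt_lpRes_apply]
    split_ifs with hk
    · rfl
    · rw [lpSwindle_apply]
      -- A copy outside `F` has no point over `B`, so a function supported over `B` restricts to
      -- zero on it.
      have h0 : lpRes hp (fun a => τ (k, a)) (injective_slice hτ k)
          (chi Z p B ξ) = 0 := by
        ext a
        rw [lpRes_apply, chi_apply, indicator_of_notMem]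
        · rfl
        · exact fun h => hk (hF k a h)
      rw [h0, map_zero]
      rfl
  · rw [sum_lpExt_lpRes_apply_of_notMem hτ hp T F _ hb, lpSwindle_apply_of_notMem hp τ hτ T _ hb]

/-- This transports a cutoff at `B` to one at a set containing the preimage of `B` under `σ`. For
`σ` close to `α k` that set can be taken bounded, where `T` is known to be compact. -/
theorem chi_comp_lpExt (hp : p ≠ ∞) (σ : Z × ℕ → Z × ℕ) (hσ : Function.Injective σ) {B U : Set X}
    (h : ∀ a, ((σ a).1 : X) ∈ B → (a.1 : X) ∈ U) :
    chi Z p B ∘L lpExt hp σ hσ = chi Z p B ∘L lpExt hp σ hσ ∘L chi Z p U := by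
  classical
  ext ξ b
  simp only [ContinuousLinearMap.comp_apply, chi_apply, indicator_apply, mem_ofPred_eq]
  split_ifs with hB
  · by_cases hb : b ∈ range σ
    · obtain ⟨a, rfl⟩ := hb
      rw [lpExt_apply, lpExt_apply, chi_apply, indicator_of_mem]
      exact h a hB
    · rw [lpExt_apply_of_notMem hp σ hσ _ hb, lpExt_apply_of_notMem hp σ hσ _ hb]
  · rfl

theorem lpRes_comp_chi (hp : p ≠ ∞) (σ : Z × ℕ → Z × ℕ) (hσ : Function.Injective σ) {B U : Set X}
    (h : ∀ a, ((σ a).1 : X) ∈ B → (a.1 : X) ∈ U) :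
    lpRes hp σ hσ ∘L chi Z p B = chi Z p U ∘L lpRes hp σ hσ ∘L chi Z p B := by
  classical
  ext ξ b
  simp only [ContinuousLinearMap.comp_apply, chi_apply, indicator_apply, mem_ofPred_eq, lpRes_apply]
  split_ifs with hB hU hU
  · rfl
  · exact absurd (h b hB) hU
  · rfl
  · rfl

/-! ### Criteria in terms of matrix entries and bounded sets -/

variable [TopologicalSpace X] {𝓔 : CoarseStructure X}

/-- The slices of a controlled open neighbourhood `O` of the diagonal serve as test neighbourhoods.
A nonvanishing block has a nonzero entry, because `p` is finite, so the support is at most `S`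
thickened by `O` on both sides. -/
theorem isControlledOp_of_entries (h𝓔 : 𝓔.IsProper) (hp : p ≠ ∞)
    {T : LpModule Z p →L[ℂ] LpModule Z p} {S : Set (X × X)} (hS : S ∈ 𝓔.controlled)
    (h : ∀ [DecidableEq (Z × ℕ)] (a b : Z × ℕ),
      (T (lp.single p a 1) : Z × ℕ → ℂ) b ≠ 0 → ((a.1 : X), (b.1 : X)) ∈ S) :
    IsControlledOp 𝓔 T := by
  classical
  obtain ⟨O, hO, hOo, hOd⟩ := h𝓔.exists_open
  refine 𝓔.subset_mem (𝓔.comp_mem hO (𝓔.comp_mem hS (𝓔.inv_mem hO))) fun q hq => ?_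
  have hU : IsOpen {u : X | (q.1, u) ∈ O} := hOo.preimage (Continuous.prodMk_right q.1)
  have hV : IsOpen {v : X | (q.2, v) ∈ O} := hOo.preimage (Continuous.prodMk_right q.2)
  have hne := hq _ _ hU (hOd (mem_diagonal q.1)) hV (hOd (mem_diagonal q.2))
  obtain ⟨a, b, ha, hb, hab⟩ := exists_entry_of_ne_zero hp T hne
  exact ⟨a.1, ha, b.1, h a b hab, hb⟩

/-- The slices of `O` are bounded and open, so finitely many of them cover a compact set. The
condition passes to subsets and to finite unions. Together with the converse
`IsLocallyCompactOp.isBounded`, this allows testing on bounded sets, which behave well under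
controlled thickening and coarse maps. -/
theorem IsLocallyCompactOp.of_isBounded (h𝓔 : 𝓔.IsProper)
    {T : LpModule Z p →L[ℂ] LpModule Z p}
    (h : ∀ B : Set X, 𝓔.IsBounded B →
      IsCompactOperator (chi Z p B ∘L T) ∧ IsCompactOperator (T ∘L chi Z p B)) :
    IsLocallyCompactOp T := by
  obtain ⟨O, hO, hOo, hOd⟩ := h𝓔.exists_open
  have mono : ∀ ⦃A B : Set X⦄, A ⊆ B →
      IsCompactOperator (chi Z p B ∘L T) ∧ IsCompactOperator (T ∘L chi Z p B) →
      IsCompactOperator (chi Z p A ∘L T) ∧ IsCompactOperator (T ∘L chi Z p A) := by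
    intro A B hAB hB
    constructor
    · rw [← chi_comp_chi_of_subset hAB, ContinuousLinearMap.comp_assoc]
      exact hB.1.clm_comp (chi Z p A)
    · rw [← chi_comp_chi_of_subset' hAB, ← ContinuousLinearMap.comp_assoc]
      exact hB.2.comp_clm (chi Z p A)
  intro K hK
  refine hK.induction_on
    (p := fun A => IsCompactOperator (chi Z p A ∘L T) ∧ IsCompactOperator (T ∘L chi Z p A))
    ?_ mono ?_ ?_
  · rw [chi_empty, ContinuousLinearMap.zero_comp, ContinuousLinearMap.comp_zero]
    exact ⟨isCompactOperator_zero, isCompactOperator_zero⟩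
  · intro A B hA hB
    have hB' := mono (sdiff_subset (s := B) (t := A)) hB
    rw [chi_union, ContinuousLinearMap.add_comp, ContinuousLinearMap.comp_add]
    exact ⟨hA.1.add hB'.1, hA.2.add hB'.2⟩
  · intro x _
    refine ⟨{y | (x, y) ∈ O}, mem_nhdsWithin_of_mem_nhds
      ((hOo.preimage (Continuous.prodMk_right x)).mem_nhds (hOd (mem_diagonal x))), h _ ?_⟩
    refine 𝓔.subset_mem ((𝓔.isBounded_singleton x).thicken hO) ?_
    exact prod_mono (fun y hy => ⟨x, rfl, hy⟩) (fun y hy => ⟨x, rfl, hy⟩)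

theorem IsLocallyCompactOp.isBounded (h𝓔 : 𝓔.IsProper)
    {T : LpModule Z p →L[ℂ] LpModule Z p} (hT : IsLocallyCompactOp T) {B : Set X}
    (hB : 𝓔.IsBounded B) :
    IsCompactOperator (chi Z p B ∘L T) ∧ IsCompactOperator (T ∘L chi Z p B) := by
  have hK := hT _ (h𝓔.isCompact_closure B hB)
  constructor
  · rw [← chi_comp_chi_of_subset (subset_closure (s := B)), ContinuousLinearMap.comp_assoc]
    exact hK.1.clm_comp (chi Z p B)
  · rw [← chi_comp_chi_of_subset' (subset_closure (s := B)), ← ContinuousLinearMap.comp_assoc]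
    exact hK.2.comp_clm (chi Z p B)

/-- Controlled operators are left multipliers of the algebra of locally compact controlled
operators. -/
theorem IsControlledOp.mul_mem_algebraicRoe (h𝓔 : 𝓔.IsProper) (hp : p ≠ ∞)
    {m T : LpModule Z p →L[ℂ] LpModule Z p} (hm : IsControlledOp 𝓔 m)
    (hT : T ∈ algebraicRoe 𝓔 h𝓔 Z p hp) : m * T ∈ algebraicRoe 𝓔 h𝓔 Z p hp := by
  refine ⟨.of_isBounded h𝓔 fun B hB => ⟨?_, ?_⟩, hm.mul h𝓔 hp hT.2⟩
  -- The rows of `m` over `B` only involve columns over a bounded set, so a cutoff to that set can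
  -- be inserted in front of `T`.
  · have h := chi_comp_eq hp (fun {_} => mem_opSupport_of_entry m) B
    have h2 := (hT.1.isBounded h𝓔 (hB.thicken_inv hm)).1
    change IsCompactOperator ((chi Z p B ∘L m) ∘L T)
    rw [h]
    exact h2.clm_comp (chi Z p B ∘L m)
  · exact (hT.1.isBounded h𝓔 hB).2.clm_comp m

theorem IsControlledOp.mem_algebraicRoe_mul (h𝓔 : 𝓔.IsProper) (hp : p ≠ ∞)
    {m T : LpModule Z p →L[ℂ] LpModule Z p} (hm : IsControlledOp 𝓔 m)
    (hT : T ∈ algebraicRoe 𝓔 h𝓔 Z p hp) : T * m ∈ algebraicRoe 𝓔 h𝓔 Z p hp := by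
  refine ⟨.of_isBounded h𝓔 fun B hB => ⟨?_, ?_⟩, hT.2.mul h𝓔 hp hm⟩
  · exact (hT.1.isBounded h𝓔 hB).1.comp_clm m
  · have h := comp_chi_eq hp (fun {_} => mem_opSupport_of_entry m) B
    have h2 := (hT.1.isBounded h𝓔 (hB.thicken hm)).2
    change IsCompactOperator (T ∘L (m ∘L chi Z p B))
    rw [h]
    exact h2.comp_clm (m ∘L chi Z p B)

theorem isControlledOp_lpExt (h𝓔 : 𝓔.IsProper) (hp : p ≠ ∞) {σ : Z × ℕ → Z × ℕ}
    (hσ : Function.Injective σ) {S : Set (X × X)} (hS : S ∈ 𝓔.controlled)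
    (h : ∀ a, ((a.1 : X), ((σ a).1 : X)) ∈ S) :
    IsControlledOp 𝓔 (lpExt (p := p) hp σ hσ) := by
  refine isControlledOp_of_entries h𝓔 hp hS fun {_} a b hab => ?_
  by_cases hb : b ∈ range σ
  · obtain ⟨c, rfl⟩ := hb
    rw [lpExt_apply] at hab
    by_cases hc : c = a
    · exact hc ▸ h a
    · exact absurd (lp.single_apply_ne p a 1 hc) hab
  · exact absurd (lpExt_apply_of_notMem hp σ hσ _ hb) hab

theorem isControlledOp_lpRes (h𝓔 : 𝓔.IsProper) (hp : p ≠ ∞) {σ : Z × ℕ → Z × ℕ}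
    (hσ : Function.Injective σ) {S : Set (X × X)} (hS : S ∈ 𝓔.controlled)
    (h : ∀ a, ((a.1 : X), ((σ a).1 : X)) ∈ S) :
    IsControlledOp 𝓔 (lpRes (p := p) hp σ hσ) := by
  refine isControlledOp_of_entries h𝓔 hp (𝓔.inv_mem hS) fun {_} a b hab => ?_
  rw [lpRes_apply] at hab
  by_cases hc : σ b = a
  · exact hc ▸ h b
  · exact absurd (lp.single_apply_ne p a 1 hc) hab

/-- The infinite sum of copies of `T` along maps close to a uniformly controlled, properly
supported sequence of coarse maps is again locally compact and controlled. -/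
theorem lpSwindle_mem_algebraicRoe (hp : p ≠ ∞) (h𝓔 : 𝓔.IsProper) {α : ℕ → X → X}
    (hα : ∀ k, 𝓔.IsCoarseMap 𝓔 (α k)) (hsupp : 𝓔.ProperlySupported α)
    (hctrl : 𝓔.UniformlyControlled α) {O : Set (X × X)} (hO : O ∈ 𝓔.controlled)
    (hclose : ∀ k a, (α k a.1, ((τ (k, a)).1 : X)) ∈ O) {T : LpModule Z p →L[ℂ] LpModule Z p}
    (hT : T ∈ algebraicRoe 𝓔 h𝓔 Z p hp) :
    lpSwindle hp τ hτ T ∈ algebraicRoe 𝓔 h𝓔 Z p hp := by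
  constructor
  · refine .of_isBounded h𝓔 fun B hB => ?_
    have hB' := hB.thicken_inv hO
    -- A copy `k` with a point over `B` forces `α k` to take a value in the `O`-thickening of `B`.
    -- This is a bounded set, so proper support leaves finitely many such `k`.
    have hfin := hsupp _ hB'
    have hF : ∀ k a, ((τ (k, a)).1 : X) ∈ B → k ∈ hfin.toFinset := fun k a h =>
      hfin.mem_toFinset.2 ⟨α k a.1, ⟨_, h, hclose k a⟩, mem_range_self _⟩
    have hU : ∀ k a, ((τ (k, a)).1 : X) ∈ B →
        (a.1 : X) ∈ α k ⁻¹' {x | ∃ y ∈ B, (x, y) ∈ O} := fun k a h => ⟨_, h, hclose k a⟩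
    -- Properness of `α k` makes the preimage of the thickening bounded, so both cutoffs of `T` to
    -- it are compact.
    have hc := fun k => hT.1.isBounded h𝓔 ((hα k).proper _ hB')
    rw [chi_comp_lpSwindle hτ hp T B _ hF, lpSwindle_comp_chi hτ hp T B _ hF]
    constructor
    · rw [ContinuousLinearMap.comp_finsetSum]
      refine Submodule.sum_mem (compactOperator (RingHom.id ℂ) (LpModule Z p) (LpModule Z p))
        fun k _ => ?_
      rw [← ContinuousLinearMap.comp_assoc, chi_comp_lpExt hp _ _ (hU k)]
      exact ((hc k).1.comp_clm (lpRes hp _ (injective_slice hτ k))).clm_comp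
        (chi Z p B ∘L lpExt hp _ (injective_slice hτ k))
    · rw [ContinuousLinearMap.finsetSum_comp]
      refine Submodule.sum_mem (compactOperator (RingHom.id ℂ) (LpModule Z p) (LpModule Z p))
        fun k _ => ?_
      rw [ContinuousLinearMap.comp_assoc, ContinuousLinearMap.comp_assoc,
        lpRes_comp_chi hp _ _ (hU k)]
      exact ((hc k).2.comp_clm (lpRes hp _ (injective_slice hτ k) ∘L chi Z p B)).clm_comp
        (lpExt hp _ (injective_slice hτ k))
  -- One set `S` serves every copy. The entry from `τ (k, c)` to `τ (k, d)` is the entry of `T` from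
  -- `c` to `d`, and there are no entries between different copies or off the copies.
  · obtain ⟨S, hS, hSα⟩ := hctrl _ hT.2
    refine isControlledOp_of_entries h𝓔 hp
      (𝓔.comp_mem (𝓔.inv_mem hO) (𝓔.comp_mem hS hO)) fun {_} a b hab => ?_
    by_cases hb : b ∈ range τ
    · obtain ⟨⟨k, d⟩, rfl⟩ := hb
      rw [lpSwindle_apply] at hab
      by_cases ha : ∃ c, τ (k, c) = a
      · obtain ⟨c, rfl⟩ := ha
        have h1 : lpRes hp (fun a => τ (k, a)) (injective_slice hτ k)
            (lp.single p (τ (k, c)) (1 : ℂ)) = lp.single p c 1 := by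
          ext e
          rw [lpRes_apply]
          by_cases hec : e = c
          · rw [hec, lp.single_apply_self, lp.single_apply_self]
          · rw [lp.single_apply_ne _ _ _ hec, lp.single_apply_ne]
            exact fun h => hec (congrArg Prod.snd (hτ h))
        rw [h1] at hab
        exact ⟨α k c.1, hclose k c, α k d.1, hSα k _ _ (mem_opSupport_of_entry T c d hab),
          hclose k d⟩
      · refine absurd ?_ hab
        have h0 : lpRes hp (fun a => τ (k, a)) (injective_slice hτ k)
            (lp.single p a (1 : ℂ)) = 0 := by
          ext e
          rw [lpRes_apply, lp.single_apply_ne]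
          · rfl
          · exact fun h => ha ⟨e, h⟩
        rw [h0, map_zero]
        rfl
    · exact absurd (lpSwindle_apply_of_notMem hp τ hτ T _ hb) hab

end Operators

/-! ### Homomorphisms from a unitization to matrices over it -/

section UnitizedMatrix

variable {B : Type*} [NormedRing B] [NormedAlgebra ℂ B] (A : NonUnitalSubalgebra ℂ B)

/-- The elements of `B` that multiply `A` into itself from both sides. -/
def multiplierAlgebra : Subalgebra ℂ B where
  carrier := {m | ∀ a ∈ A, m * a ∈ A ∧ a * m ∈ A}
  mul_mem' {x y} hx hy a ha := by
    constructor
    · rw [mul_assoc]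
      exact (hx _ (hy a ha).1).1
    · rw [← mul_assoc]
      exact (hy _ (hx a ha).2).2
  add_mem' {x y} hx hy a ha := by
    rw [add_mul, mul_add]
    exact ⟨add_mem (hx a ha).1 (hy a ha).1, add_mem (hx a ha).2 (hy a ha).2⟩
  algebraMap_mem' c a ha := by
    rw [← Algebra.commutes, ← Algebra.smul_def]
    exact ⟨SMulMemClass.smul_mem c ha, SMulMemClass.smul_mem c ha⟩

variable {A} {n : Type*}

theorem matrix_one_mem_multiplierAlgebra [DecidableEq n] (i j : n) :
    (1 : Matrix n n B) i j ∈ multiplierAlgebra A := by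
  rw [Matrix.one_apply]
  split_ifs
  · exact one_mem _
  · exact zero_mem _

theorem conj_apply_mem [Fintype n] {U V M : Matrix n n B} (hU : ∀ i j, U i j ∈ multiplierAlgebra A)
    (hV : ∀ i j, V i j ∈ multiplierAlgebra A) (hM : ∀ i j, M i j ∈ A) (i j : n) :
    (U * M * V) i j ∈ A := by
  rw [Matrix.mul_apply]
  refine sum_mem fun k _ => (hV k j _ ?_).2
  rw [Matrix.mul_apply]
  exact sum_mem fun l _ => (hU i l _ (hM l k)).1

variable (A) [Fintype n] [DecidableEq n]

/-- The homomorphism `c + a ↦ c + a` from `A⁺` to `B`. -/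
noncomputable def unitizedToAmbient : Unitized A →+* B :=
  ((Unitization.lift (NonUnitalSubalgebraClass.subtype A)).comp
    (WithLp.unitizationAlgEquiv (𝕜 := ℂ) (A := A) ℂ).toAlgHom).toRingHom

variable {A}

theorem augmentation_toLp (c : ℂ) (a : A) :
    augmentation A (WithLp.toLp 1 (Unitization.inl c + Unitization.inr a)) = c := by
  change (Unitization.inl c + Unitization.inr a : Unitization ℂ A).fst = c
  simp

theorem unitizedToAmbient_toLp (c : ℂ) (a : A) :
    unitizedToAmbient A (WithLp.toLp 1 (Unitization.inl c + Unitization.inr a))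
      = algebraMap ℂ B c + a := by
  change Unitization.lift (NonUnitalSubalgebraClass.subtype A)
    (Unitization.inl c + Unitization.inr a : Unitization ℂ A) = _
  simp [Unitization.lift]

theorem toLp_surjective (x : Unitized A) :
    ∃ c a, x = WithLp.toLp 1 (Unitization.inl c + Unitization.inr a) :=
  ⟨x.ofLp.fst, x.ofLp.snd, by rw [Unitization.inl_fst_add_inr_snd_eq]⟩

/-- The augmentation reads off the scalar, and the map to `B` then determines the element of `A`.
Both are needed, since the map to `B` alone is not injective when `A` contains the unit of `B`. -/
theorem unitized_ext {x y : Unitized A} (h1 : augmentation A x = augmentation A y)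
    (h2 : unitizedToAmbient A x = unitizedToAmbient A y) : x = y := by
  obtain ⟨c, a, rfl⟩ := toLp_surjective x
  obtain ⟨d, b, rfl⟩ := toLp_surjective y
  rw [augmentation_toLp, augmentation_toLp] at h1
  subst h1
  rw [unitizedToAmbient_toLp, unitizedToAmbient_toLp, add_right_inj] at h2
  rw [Subtype.ext h2]

theorem unitized_matrix_ext {m : Type*} [Fintype m] [DecidableEq m]
    {x y : Matrix m m (Unitized A)}
    (h1 : (augmentation A).mapMatrix x = (augmentation A).mapMatrix y)
    (h2 : (unitizedToAmbient A).mapMatrix x = (unitizedToAmbient A).mapMatrix y) : x = y := by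
  ext i j
  exact unitized_ext (congrFun₂ h1 i j) (congrFun₂ h2 i j)

/-- The unital extension `c + a ↦ c + f a` of a homomorphism `f : A → M_n(B)`. -/
noncomputable def ambientLift (f : A →ₙₐ[ℂ] Matrix n n B) : Unitized A →+* Matrix n n B :=
  ((Unitization.lift f).comp
    (WithLp.unitizationAlgEquiv (𝕜 := ℂ) (A := A) ℂ).toAlgHom).toRingHom

theorem ambientLift_toLp (f : A →ₙₐ[ℂ] Matrix n n B) (c : ℂ) (a : A) :
    ambientLift f (WithLp.toLp 1 (Unitization.inl c + Unitization.inr a))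
      = algebraMap ℂ (Matrix n n B) c + f a := by
  change Unitization.lift f (Unitization.inl c + Unitization.inr a : Unitization ℂ A) = _
  simp [Unitization.lift]

/-- The underlying function of `unitizedMatrixHom`. -/
noncomputable def unitizedMatrixFun (f : A →ₙₐ[ℂ] Matrix n n B) (hf : ∀ a i j, f a i j ∈ A)
    (x : Unitized A) : Matrix n n (Unitized A) :=
  Matrix.of fun i j => WithLp.toLp 1 (Unitization.inl (if i = j then x.ofLp.fst else 0)
    + Unitization.inr ⟨f x.ofLp.snd i j, hf _ i j⟩)

theorem augmentation_unitizedMatrixFun (f : A →ₙₐ[ℂ] Matrix n n B) (hf : ∀ a i j, f a i j ∈ A)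
    (x : Unitized A) : (augmentation A).mapMatrix (unitizedMatrixFun f hf x)
      = Matrix.scalar n (augmentation A x) := by
  ext i j
  refine (augmentation_toLp _ _).trans ?_
  rw [Matrix.scalar_apply, Matrix.diagonal_apply]
  rfl

theorem unitizedToAmbient_unitizedMatrixFun (f : A →ₙₐ[ℂ] Matrix n n B)
    (hf : ∀ a i j, f a i j ∈ A) (x : Unitized A) :
    (unitizedToAmbient A).mapMatrix (unitizedMatrixFun f hf x) = ambientLift f x := by
  obtain ⟨c, a, rfl⟩ := toLp_surjective x
  ext i j
  refine (unitizedToAmbient_toLp _ _).trans ?_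
  rw [ambientLift_toLp, Matrix.add_apply, Matrix.algebraMap_matrix_apply]
  congr 1
  · split_ifs <;> simp
  · simp

/-- The homomorphism `c + a ↦ c + f a` from `A⁺` to `M_n(A⁺)` induced by a homomorphism `f` from
`A` to `M_n(A) ⊆ M_n(B)`. -/
noncomputable def unitizedMatrixHom (f : A →ₙₐ[ℂ] Matrix n n B) (hf : ∀ a i j, f a i j ∈ A) :
    Unitized A →+* Matrix n n (Unitized A) where
  toFun := unitizedMatrixFun f hf
  map_one' := by
    -- After augmentation the function becomes the scalar matrix of the augmentation, and in the
    -- ambient algebra it becomes `ambientLift f`. Both are ring homomorphisms, so the identities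
    -- can be checked there.
    apply unitized_matrix_ext <;>
      simp only [augmentation_unitizedMatrixFun, unitizedToAmbient_unitizedMatrixFun, map_one]
  map_zero' := by
    apply unitized_matrix_ext <;>
      simp only [augmentation_unitizedMatrixFun, unitizedToAmbient_unitizedMatrixFun, map_zero]
  map_mul' x y := by
    apply unitized_matrix_ext <;>
      simp only [augmentation_unitizedMatrixFun, unitizedToAmbient_unitizedMatrixFun, map_mul]
  map_add' x y := by
    refine unitized_matrix_ext ?_ ?_
    · rw [map_add, augmentation_unitizedMatrixFun, augmentation_unitizedMatrixFun,
        augmentation_unitizedMatrixFun, RingHom.map_add (augmentation A), map_add]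
    · rw [map_add, unitizedToAmbient_unitizedMatrixFun, unitizedToAmbient_unitizedMatrixFun,
        unitizedToAmbient_unitizedMatrixFun, RingHom.map_add (ambientLift f)]

theorem unitizedMatrixHom_congr {f f' : A →ₙₐ[ℂ] Matrix n n B} (hf : ∀ a i j, f a i j ∈ A)
    (hf' : ∀ a i j, f' a i j ∈ A) (h : ∀ a, f a = f' a) :
    unitizedMatrixHom f hf = unitizedMatrixHom f' hf' := by
  obtain rfl : f = f' := NonUnitalAlgHom.ext h
  rfl

theorem augmentation_unitizedMatrixHom (f : A →ₙₐ[ℂ] Matrix n n B) (hf : ∀ a i j, f a i j ∈ A)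
    (x : Unitized A) (i j : n) : augmentation A (unitizedMatrixHom f hf x i j)
      = if i = j then augmentation A x else 0 := by
  have := congrFun₂ (augmentation_unitizedMatrixFun f hf x) i j
  rwa [Matrix.scalar_apply, Matrix.diagonal_apply] at this

theorem unitizedToAmbient_unitizedMatrixHom (f : A →ₙₐ[ℂ] Matrix n n B)
    (hf : ∀ a i j, f a i j ∈ A) (x : Unitized A) (i j : n) :
    unitizedToAmbient A (unitizedMatrixHom f hf x i j) = ambientLift f x i j :=
  congrFun₂ (unitizedToAmbient_unitizedMatrixFun f hf x) i j

theorem continuous_unitizedMatrixHom {T : Type*} [TopologicalSpace T]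
    {f : T → A →ₙₐ[ℂ] Matrix n n B} (hf : ∀ t a i j, f t a i j ∈ A)
    (hc : ∀ a, Continuous fun t => f t a) (x : Unitized A) :
    Continuous fun t => unitizedMatrixHom (f t) (hf t) x := by
  refine continuous_matrix fun i j => ?_
  have h : ∀ t, unitizedMatrixHom (f t) (hf t) x i j
      = WithLp.toLp 1 (Unitization.inl (if i = j then x.ofLp.fst else 0))
        + WithLp.toLp 1 (Unitization.inr (⟨f t x.ofLp.snd i j, hf t _ i j⟩ : A)) := fun t => rfl
  simp only [h]
  refine continuous_const.add (WithLp.unitization_isometry_inr.continuous.comp ?_)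
  exact ((hc _).matrix_elem i j).subtype_mk _

/-! ### Conjugate and diagonal homomorphisms, and homotopies between them -/

/-- Conjugation of a homomorphism into matrices by a matrix `U` with left inverse `V`. -/
noncomputable def conjHom (f : A →ₙₐ[ℂ] Matrix n n B) {U V : Matrix n n B} (h : V * U = 1) :
    A →ₙₐ[ℂ] Matrix n n B where
  toFun a := U * f a * V
  map_smul' c a := by simp
  map_zero' := by simp
  map_add' a b := by rw [map_add, mul_add, add_mul]
  map_mul' a b := by
    rw [map_mul]
    calc U * (f a * f b) * V = U * f a * 1 * f b * V := by simp only [mul_one, mul_assoc]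
      _ = U * f a * V * (U * f b * V) := by rw [← h]; simp only [mul_assoc]

/-- The diagonal homomorphism with given entries. -/
noncomputable def diagonalHom (g : n → A →ₙₐ[ℂ] A) : A →ₙₐ[ℂ] Matrix n n B where
  toFun a := Matrix.diagonal fun i => (g i a : B)
  map_smul' c a := by ext i j; simp [Matrix.diagonal_apply]
  map_zero' := by ext i j; simp
  map_add' a b := by ext i j; simp [Matrix.diagonal_apply]; split_ifs <;> simp
  map_mul' a b := by simp [Matrix.diagonal_mul_diagonal]

theorem diagonalHom_apply (g : n → A →ₙₐ[ℂ] A) (a : A) :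
    diagonalHom g a = Matrix.diagonal fun i => (g i a : B) := rfl

theorem diagonalHom_apply_mem (g : n → A →ₙₐ[ℂ] A) (a : A) (i j : n) :
    diagonalHom g a i j ∈ A := by
  rw [diagonalHom_apply, Matrix.diagonal_apply]
  split_ifs
  · exact (g i a).2
  · exact zero_mem A

/-- The unital extension `c + a ↦ c + g a` of an endomorphism `g` of `A`. -/
noncomputable def unitizedHom (g : A →ₙₐ[ℂ] A) : Unitized A →+* Unitized A :=
  ((WithLp.unitizationAlgEquiv (𝕜 := ℂ) (A := A) ℂ).symm.toAlgHom.comp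
    ((Unitization.lift ((Unitization.inrNonUnitalAlgHom ℂ A).comp g)).comp
      (WithLp.unitizationAlgEquiv (𝕜 := ℂ) (A := A) ℂ).toAlgHom)).toRingHom

theorem unitizedHom_toLp (g : A →ₙₐ[ℂ] A) (c : ℂ) (a : A) :
    unitizedHom g (WithLp.toLp 1 (Unitization.inl c + Unitization.inr a))
      = WithLp.toLp 1 (Unitization.inl c + Unitization.inr (g a)) := by
  refine congrArg (WithLp.toLp 1) ?_
  change Unitization.lift ((Unitization.inrNonUnitalAlgHom ℂ A).comp g)
    (Unitization.inl c + Unitization.inr a : Unitization ℂ A) = _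
  simp [Unitization.lift, Unitization.algebraMap_eq_inl]

theorem unitizedHom_id : unitizedHom (NonUnitalAlgHom.id ℂ A) = RingHom.id (Unitized A) := by
  ext1 x
  obtain ⟨c, a, rfl⟩ := toLp_surjective x
  rw [unitizedHom_toLp]
  rfl

theorem unitizedHom_zero_apply (x : Unitized A) :
    unitizedHom (0 : A →ₙₐ[ℂ] A) x = algebraMap ℂ (Unitized A) (augmentation A x) := by
  obtain ⟨c, a, rfl⟩ := toLp_surjective x
  rw [unitizedHom_toLp, augmentation_toLp]
  refine congrArg (WithLp.toLp 1) ?_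
  simp [Unitization.algebraMap_eq_inl]

theorem unitizedMatrixHom_diagonalHom (g : n → A →ₙₐ[ℂ] A) (x : Unitized A) :
    unitizedMatrixHom (diagonalHom g) (diagonalHom_apply_mem g) x
      = Matrix.diagonal fun i => unitizedHom (g i) x := by
  obtain ⟨c, a, rfl⟩ := toLp_surjective x
  ext i j
  apply unitized_ext
  · rw [augmentation_unitizedMatrixHom, Matrix.diagonal_apply]
    split_ifs
    · rw [unitizedHom_toLp, augmentation_toLp, augmentation_toLp]
    · rw [map_zero]
  · rw [unitizedToAmbient_unitizedMatrixHom, Matrix.diagonal_apply, ambientLift_toLp,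
      Matrix.add_apply, Matrix.algebraMap_matrix_apply, diagonalHom_apply, Matrix.diagonal_apply]
    split_ifs
    · rw [unitizedHom_toLp, unitizedToAmbient_toLp]
    · rw [map_zero, add_zero]

/-- Two homomorphisms `A⁺ → M_n(A⁺)` are joined by a path, parametrized by `ℂ ∖ {1}`, of
homomorphisms that are compatible with the augmentation. -/
def AugHomotopic (h h' : Unitized A →+* Matrix n n (Unitized A)) : Prop :=
  ∃ H : ({1}ᶜ : Set ℂ) → Unitized A →+* Matrix n n (Unitized A),
    (∀ x, Continuous fun s => H s x) ∧
    (∀ s x i j, augmentation A (H s x i j) = if i = j then augmentation A x else 0) ∧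
    (∃ s, H s = h) ∧ ∃ s, H s = h'

/-- Conjugation by an involution that multiplies `A` into itself is homotopic to the identity. -/
theorem augHomotopic_of_involution {f f' : A →ₙₐ[ℂ] Matrix n n B} (hf : ∀ a i j, f a i j ∈ A)
    (hf' : ∀ a i j, f' a i j ∈ A) {U : Matrix n n B} (hU : ∀ i j, U i j ∈ multiplierAlgebra A)
    (hUU : U * U = 1) (h : ∀ a, U * f a * U = f' a) :
    AugHomotopic (unitizedMatrixHom f hf) (unitizedMatrixHom f' hf') := by
  -- The involution is `U = 1 - 2P` with `P` idempotent. The path is `1 - sP`, with inverse `1 + (s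
  -- / (1 - s)) P` for `s ≠ 1`; it equals `1` at `s = 0` and `U` at `s = 2`. All its entries are
  -- multipliers, so conjugation along it keeps the values in matrices over `A`.
  set P : Matrix n n B := (2⁻¹ : ℂ) • (1 - U) with hP
  have hPmem : ∀ i j, P i j ∈ multiplierAlgebra A := fun i j =>
    (multiplierAlgebra A).smul_mem (sub_mem (matrix_one_mem_multiplierAlgebra i j) (hU i j)) _
  have hPP : P * P = P := by
    rw [hP, smul_mul_smul_comm, sub_mul, mul_sub, mul_sub, hUU, mul_one, mul_one, one_mul,
      show (1 : Matrix n n B) - U - (U - 1) = (2 : ℂ) • (1 - U) by rw [two_smul]; abel, smul_smul]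
    norm_num
  have hmem : ∀ (c d : ℂ) i j, (c • (1 : Matrix n n B) + d • P) i j ∈ multiplierAlgebra A :=
    fun c d i j => add_mem ((multiplierAlgebra A).smul_mem (matrix_one_mem_multiplierAlgebra i j) c)
      ((multiplierAlgebra A).smul_mem (hPmem i j) d)
  have hinv : ∀ s : ({1}ᶜ : Set ℂ), ((1 : ℂ) • (1 : Matrix n n B) + ((s : ℂ) / (1 - s)) • P) *
      ((1 : ℂ) • (1 : Matrix n n B) + (-s : ℂ) • P) = 1 := by
    rintro ⟨s, hs⟩
    have hs' : (1 : ℂ) - s ≠ 0 := sub_ne_zero.2 (Ne.symm hs)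
    have h0 : (-s : ℂ) + s / (1 - s) + s / (1 - s) * -s = 0 := by
      field_simp
      ring
    rw [one_smul, mul_add, add_mul, add_mul, one_mul, mul_one, one_mul, smul_mul_smul_comm, hPP]
    calc (1 : Matrix n n B) + (s / (1 - s)) • P + ((-s) • P + (s / (1 - s) * -s) • P)
        = 1 + ((-s : ℂ) + s / (1 - s) + s / (1 - s) * -s) • P := by
          rw [add_smul, add_smul]; abel
      _ = 1 := by rw [h0, zero_smul, add_zero]
  refine ⟨fun s => unitizedMatrixHom (conjHom f (hinv s))
    (fun a => conj_apply_mem (hmem _ _) (hmem _ _) (hf a)), ?_, ?_, ⟨⟨0, by simp⟩, ?_⟩,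
    ⟨⟨2, by norm_num⟩, ?_⟩⟩
  · refine continuous_unitizedMatrixHom _ fun a => ?_
    have h1 : Continuous fun s : ({1}ᶜ : Set ℂ) => (s : ℂ) / (1 - s) :=
      continuous_subtype_val.div (continuous_const.sub continuous_subtype_val)
        fun s => sub_ne_zero.2 (Ne.symm s.2)
    change Continuous fun s : ({1}ᶜ : Set ℂ) => ((1 : ℂ) • (1 : Matrix n n B) + (-s : ℂ) • P) * f a *
      ((1 : ℂ) • (1 : Matrix n n B) + ((s : ℂ) / (1 - s)) • P)
    fun_prop
  · exact fun s x i j => augmentation_unitizedMatrixHom _ _ x i j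
  · refine unitizedMatrixHom_congr _ _ fun a => ?_
    change ((1 : ℂ) • (1 : Matrix n n B) + (-0 : ℂ) • P) * f a *
      ((1 : ℂ) • (1 : Matrix n n B) + ((0 : ℂ) / (1 - 0)) • P) = f a
    simp
  · refine unitizedMatrixHom_congr _ _ fun a => ?_
    change ((1 : ℂ) • (1 : Matrix n n B) + (-2 : ℂ) • P) * f a *
      ((1 : ℂ) • (1 : Matrix n n B) + ((2 : ℂ) / (1 - 2)) • P) = f' a
    have h1 : (1 : ℂ) • (1 : Matrix n n B) + (-2 : ℂ) • P = U := by
      rw [hP, smul_smul, show (-2 : ℂ) * 2⁻¹ = -1 by norm_num, one_smul, neg_smul, one_smul]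
      abel
    rw [show (2 : ℂ) / (1 - 2) = -2 by norm_num, h1, h]

end UnitizedMatrix

/-! ### Homotopy invariance -/

section Homotopy

/-- Nearby idempotents are conjugate by a unit, hence equivalent. Equivalence of idempotents is
transitive, so connectedness of the parameter space propagates it. -/
theorem exists_mul_eq_of_continuous_idempotent {S T : Type*} [NormedRing S] [CompleteSpace S]
    [TopologicalSpace T] [PreconnectedSpace T] {e : T → S} (hc : Continuous e)
    (he : ∀ t, e t * e t = e t) (s t : T) : ∃ x y : S, x * y = e s ∧ y * x = e t := by
  refine PreconnectedSpace.induction₂' (fun s t => ∃ x y : S, x * y = e s ∧ y * x = e t) ?_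
    ⟨?_⟩ s t
  · intro s
    -- This element intertwines `e s` and `e t`. It is `1` at `t = s`, hence invertible for `t` near
    -- `s`; completeness enters here, through the openness of the units.
    have hz : Continuous fun t => e t * e s + (1 - e t) * (1 - e s) := by fun_prop
    have h1 : IsUnit (e s * e s + (1 - e s) * (1 - e s)) := by
      simp [sub_mul, mul_sub, he]
    filter_upwards [hz.continuousAt.preimage_mem_nhds (Units.isOpen.mem_nhds h1)] with t ht
    obtain ⟨z, hz⟩ := ht
    have h2 : (z : S) * e s = e t * z := by
      rw [hz, add_mul, mul_add, mul_assoc, he, mul_assoc, sub_mul 1 (e s), he, ← mul_assoc (e t),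
        he, ← mul_assoc (e t), mul_sub (e t), he]
      simp
    have h3 : (e s * ↑z⁻¹) * (z * e s) = e s := by
      rw [mul_assoc, Units.inv_mul_cancel_left, he]
    have h4 : (z * e s) * (e s * ↑z⁻¹) = e t := by
      rw [mul_assoc, ← mul_assoc (e s), he, ← mul_assoc, h2, Units.mul_inv_cancel_right]
    exact ⟨⟨_, _, h3, h4⟩, ⟨_, _, h4, h3⟩⟩
  · rintro r s t ⟨x, y, h1, h2⟩ ⟨z, w, h3, h4⟩
    refine ⟨x * z, w * y, ?_, ?_⟩
    · calc x * z * (w * y) = x * (z * w) * y := by simp only [mul_assoc]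
        _ = (x * y) * (x * y) := by rw [h3, ← h2]; simp only [mul_assoc]
        _ = e r := by rw [h1, he]
    · calc w * y * (x * z) = w * (y * x) * z := by simp only [mul_assoc]
        _ = (w * z) * (w * z) := by rw [h2, ← h3]; simp only [mul_assoc]
        _ = e t := by rw [h4, he]

theorem MatEquiv.of_continuous {R T ι : Type*} [NormedRing R] [CompleteSpace R]
    [Fintype ι] [DecidableEq ι] [TopologicalSpace T] [PreconnectedSpace T]
    {e : T → Matrix ι ι R} (hc : Continuous e) (he : ∀ t, e t * e t = e t) (s t : T) :
    MatEquiv (e s) (e t) :=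
  -- The operator norm is auxiliary: it makes the matrices a normed ring and induces the entrywise
  -- topology.
  @exists_mul_eq_of_continuous_idempotent (Matrix ι ι R) T Matrix.linftyOpNormedRing
    (inferInstanceAs (CompleteSpace (ι → ι → R))) _ _ e hc he s t

/-- The path `1 - sP` is singular at `s = 1`. Removing that point leaves `ℂ` connected, whereas on
the real line it would separate `0` from `2`. -/
instance : PreconnectedSpace ({1}ᶜ : Set ℂ) :=
  Subtype.preconnectedSpace
    (isConnected_compl_singleton_of_one_lt_rank (by simp) 1).isPreconnected

variable {B : Type*} [NormedRing B] [NormedAlgebra ℂ B] {A : NonUnitalSubalgebra ℂ B}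
  {n : Type*} [Fintype n] [DecidableEq n]

/-- The entrywise application of a homomorphism into matrices, as a block matrix. -/
def blockHom {R S : Type*} [Ring R] [Ring S] (ι : Type*) [Fintype ι] [DecidableEq ι]
    (h : R →+* Matrix n n S) : Matrix ι ι R →+* Matrix (n × ι) (n × ι) S :=
  (Matrix.reindexRingEquiv S (Equiv.prodComm ι n)).toRingHom.comp
    ((Matrix.compRingEquiv ι n S).toRingHom.comp h.mapMatrix)

theorem blockHom_apply {R S ι : Type*} [Ring R] [Ring S] [Fintype ι] [DecidableEq ι]
    (h : R →+* Matrix n n S) (M : Matrix ι ι R) (i j : n × ι) :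
    blockHom ι h M i j = h (M i.2 j.2) i.1 j.1 := rfl

theorem AugHomotopic.matEquiv {ι : Type*} [Fintype ι] [DecidableEq ι] [CompleteSpace A]
    {h h' : Unitized A →+* Matrix n n (Unitized A)} (hh : AugHomotopic h h')
    {e : Matrix ι ι (Unitized A)} (he : e * e = e) :
    MatEquiv (blockHom ι h e) (blockHom ι h' e) := by
  obtain ⟨H, hc, -, ⟨s, rfl⟩, ⟨t, rfl⟩⟩ := hh
  refine MatEquiv.of_continuous (e := fun s => blockHom ι (H s) e) ?_ ?_ s t
  · refine continuous_matrix fun i j => ?_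
    simp only [blockHom_apply]
    exact (hc _).matrix_elem _ _
  · intro s
    rw [← map_mul, he]

/-- Reindexing by `σ` groups the entries by their block in `Fin 3`, which turns the matrix into the
iterated block sum up to equivalence. -/
theorem matEquiv_blockHom_diagonal {R : Type*} [Ring R] (g : Fin 3 → R →+* R)
    (h : R →+* Matrix (Fin 3) (Fin 3) R) (hg : ∀ x, h x = Matrix.diagonal fun i => g i x)
    (e : IdemMatrix R) : MatEquiv (blockHom (Fin e.size) h e.mat)
      ((e.map (g 0)).add ((e.map (g 1)).add (e.map (g 2)))).mat := by
  have hidem : blockHom (Fin e.size) h e.mat * blockHom (Fin e.size) h e.mat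
      = blockHom (Fin e.size) h e.mat := by rw [← map_mul, e.idem]
  let σ : Fin e.size ⊕ (Fin e.size ⊕ Fin e.size) ≃ Fin 3 × Fin e.size :=
    { toFun := Sum.elim (fun i => (0, i)) (Sum.elim (fun i => (1, i)) fun i => (2, i))
      invFun := fun i => ![Sum.inl i.2, Sum.inr (Sum.inl i.2), Sum.inr (Sum.inr i.2)] i.1
      left_inv := by rintro (i | i | i) <;> rfl
      right_inv := by rintro ⟨k, i⟩; fin_cases k <;> rfl }
  have h1 := MatEquiv.submatrix hidem σ
  have h2 : (blockHom (Fin e.size) h e.mat).submatrix σ σ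
      = Matrix.fromBlocks (e.map (g 0)).mat 0 0
        (Matrix.fromBlocks (e.map (g 1)).mat 0 0 (e.map (g 2)).mat) := by
    ext (i | i | i) (j | j | j) <;>
      simp [blockHom_apply, hg, σ, IdemMatrix.map] <;> rfl
  have i1 := fromBlocks_idem (e.map (g 0)).idem
    (fromBlocks_idem (e.map (g 1)).idem (e.map (g 2)).idem)
  have i2 := ((e.map (g 0)).add ((e.map (g 1)).add (e.map (g 2)))).idem
  have hr : MatEquiv (e.map (g 0)).mat (e.map (g 0)).mat :=
    ⟨_, _, (e.map (g 0)).idem, (e.map (g 0)).idem⟩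
  rw [h2] at h1
  refine h1.trans hidem i2 (MatEquiv.trans i1 i2
    (hr.fromBlocks (IdemMatrix.matEquiv_add (e.map (g 1)) (e.map (g 2)))) ?_)
  exact IdemMatrix.matEquiv_add (e.map (g 0)) ((e.map (g 1)).add (e.map (g 2)))

/-- The class in `V(R)` of an idempotent matrix. -/
def IdemMatrix.toClass {R : Type*} [Ring R] (e : IdemMatrix R) : IdemClass R := Quotient.mk _ e

theorem AugHomotopic.toClass_eq [CompleteSpace A] {g g' : Fin 3 → A →ₙₐ[ℂ] A}
    (hh : AugHomotopic (unitizedMatrixHom (diagonalHom g) (diagonalHom_apply_mem g))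
      (unitizedMatrixHom (diagonalHom g') (diagonalHom_apply_mem g')))
    (e : IdemMatrix (Unitized A)) :
    (e.map (unitizedHom (g 0))).toClass
        + ((e.map (unitizedHom (g 1))).toClass + (e.map (unitizedHom (g 2))).toClass)
      = (e.map (unitizedHom (g' 0))).toClass
        + ((e.map (unitizedHom (g' 1))).toClass + (e.map (unitizedHom (g' 2))).toClass) := by
  have h1 := matEquiv_blockHom_diagonal (fun i => unitizedHom (g i)) _
    (unitizedMatrixHom_diagonalHom g) e
  have h2 := matEquiv_blockHom_diagonal (fun i => unitizedHom (g' i)) _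
    (unitizedMatrixHom_diagonalHom g') e
  have hidem : ∀ h : Unitized A →+* Matrix (Fin 3) (Fin 3) (Unitized A),
      blockHom (Fin e.size) h e.mat * blockHom (Fin e.size) h e.mat
        = blockHom (Fin e.size) h e.mat := fun h => by rw [← map_mul, e.idem]
  refine Quotient.sound (h1.symm.trans (IdemMatrix.idem _) (IdemMatrix.idem _) ?_)
  exact (hh.matEquiv e.idem).trans (hidem _) (IdemMatrix.idem _) h2

theorem UnitalK0.map_of {R S : Type*} [Ring R] [Ring S] (φ : R →+* S) (c : IdemClass R) :
    UnitalK0.map φ (Algebra.GrothendieckAddGroup.of c)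
      = Algebra.GrothendieckAddGroup.of (IdemClass.map φ c) :=
  DFunLike.congr_fun (Algebra.GrothendieckAddGroup.lift.symm_apply_apply
    (Algebra.GrothendieckAddGroup.of.comp (IdemClass.map φ))) c

/-- The unital extension of the zero map is the composite `A⁺ → ℂ → A⁺`. By hypothesis it acts as
the identity on `K₀(A⁺)`, so `K₀(A⁺) → K₀(ℂ)` is injective and its kernel is trivial. -/
theorem subsingleton_BanachK0_of_map_eq
    (h : ∀ e : IdemMatrix (Unitized A), Algebra.GrothendieckAddGroup.of e.toClass
      = Algebra.GrothendieckAddGroup.of (e.map (unitizedHom (0 : A →ₙₐ[ℂ] A))).toClass) :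
    Subsingleton (BanachK0 A) := by
  have key : ∀ x : UnitalK0 (Unitized A), UnitalK0.map (algebraMap ℂ (Unitized A))
      (UnitalK0.map (augmentation A) x) = x := by
    intro x
    have : (UnitalK0.map (algebraMap ℂ (Unitized A))).comp (UnitalK0.map (augmentation A))
        = AddMonoidHom.id _ := by
      refine Algebra.GrothendieckAddGroup.lift.symm.injective (AddMonoidHom.ext fun c => ?_)
      induction c using Quotient.inductionOn with
      | h e =>
        refine Eq.trans ?_ (h e).symm
        change UnitalK0.map (algebraMap ℂ (Unitized A)) (UnitalK0.map (augmentation A)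
          (Algebra.GrothendieckAddGroup.of e.toClass)) = _
        rw [UnitalK0.map_of, UnitalK0.map_of]
        refine congrArg (fun e => Algebra.GrothendieckAddGroup.of (IdemMatrix.toClass e)) ?_
        have : (e.mat.map (augmentation A)).map (algebraMap ℂ (Unitized A))
            = e.mat.map (unitizedHom (0 : A →ₙₐ[ℂ] A)) := by
          ext i j
          exact (unitizedHom_zero_apply _).symm
        simp only [IdemMatrix.map, IdemMatrix.mk.injEq, heq_eq_eq, true_and]
        exact this
    exact DFunLike.congr_fun this x
  refine ⟨fun x y => Subtype.ext ?_⟩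
  rw [← key x, ← key y, AddMonoidHom.mem_ker.1 x.2, AddMonoidHom.mem_ker.1 y.2]

end Homotopy

/-! ### Vanishing of `K₁` -/

section GeneralLinear

variable {B : Type*} [NormedRing B] [NormedAlgebra ℂ B] {A : NonUnitalSubalgebra ℂ B}

/-- The entrywise application of a homomorphism into `3 × 3` matrices, with consecutive blocks. -/
def tripleHom {R S : Type*} [Ring R] [Ring S] (h : R →+* Matrix (Fin 3) (Fin 3) S) (n : ℕ) :
    Matrix (Fin n) (Fin n) R →+* Matrix (Fin (3 * n)) (Fin (3 * n)) S :=
  (Matrix.reindexRingEquiv S finProdFinEquiv).toRingHom.comp (blockHom (Fin n) h)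

theorem tripleHom_apply {R S : Type*} [Ring R] [Ring S] (h : R →+* Matrix (Fin 3) (Fin 3) S)
    {n : ℕ} (M : Matrix (Fin n) (Fin n) R) (i j : Fin 3 × Fin n) :
    tripleHom h n M (finProdFinEquiv i) (finProdFinEquiv j) = h (M i.2 j.2) i.1 j.1 := by
  change h (M (finProdFinEquiv.symm (finProdFinEquiv i)).2
    (finProdFinEquiv.symm (finProdFinEquiv j)).2) (finProdFinEquiv.symm (finProdFinEquiv i)).1
    (finProdFinEquiv.symm (finProdFinEquiv j)).1 = _
  rw [Equiv.symm_apply_apply, Equiv.symm_apply_apply]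

theorem matrix_triple_ext {S : Type*} {n : ℕ} {M N : Matrix (Fin (3 * n)) (Fin (3 * n)) S}
    (h : ∀ i j : Fin 3 × Fin n, M (finProdFinEquiv i) (finProdFinEquiv j)
      = N (finProdFinEquiv i) (finProdFinEquiv j)) : M = N := by
  ext i j
  rw [← finProdFinEquiv.apply_symm_apply i, ← finProdFinEquiv.apply_symm_apply j, h]

theorem GLn.augmentation_apply {n : ℕ} (u : GLn A n) (i j : Fin n) :
    augmentation A (((u : (Matrix (Fin n) (Fin n) (Unitized A))ˣ) :
      Matrix (Fin n) (Fin n) (Unitized A)) i j) = (1 : Matrix (Fin n) (Fin n) ℂ) i j := by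
  have h : (augmentation A).mapMatrix
      ((u : (Matrix (Fin n) (Fin n) (Unitized A))ˣ) : Matrix (Fin n) (Fin n) (Unitized A)) = 1 :=
    congrArg Units.val (MonoidHom.mem_ker.1 u.2)
  exact congrFun₂ h i j

/-- The homomorphism `GL_n(A) → GL_{3n}(A)` induced by a homomorphism `A⁺ → M_3(A⁺)` that is
compatible with the augmentation. -/
noncomputable def tripleGL {h : Unitized A →+* Matrix (Fin 3) (Fin 3) (Unitized A)}
    (hh : ∀ x i j, augmentation A (h x i j) = if i = j then augmentation A x else 0) (n : ℕ) :
    GLn A n →* GLn A (3 * n) :=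
  ((Units.map (tripleHom h n).toMonoidHom).comp (GLn A n).subtype).codRestrict (GLn A (3 * n))
    fun u => by
      refine MonoidHom.mem_ker.2 (Units.ext (matrix_triple_ext fun i j => ?_))
      change augmentation A (tripleHom h n _ (finProdFinEquiv i) (finProdFinEquiv j))
        = (1 : Matrix (Fin (3 * n)) (Fin (3 * n)) ℂ) _ _
      rw [tripleHom_apply, hh]
      refine (if_congr Iff.rfl (GLn.augmentation_apply u i.2 j.2) rfl).trans ?_
      simp only [Matrix.one_apply, EmbeddingLike.apply_eq_iff_eq, Prod.ext_iff]
      split_ifs <;> tauto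

theorem tripleGL_apply {h : Unitized A →+* Matrix (Fin 3) (Fin 3) (Unitized A)}
    (hh : ∀ x i j, augmentation A (h x i j) = if i = j then augmentation A x else 0) {n : ℕ}
    (u : GLn A n) (i j : Fin 3 × Fin n) :
    ((tripleGL hh n u : (Matrix (Fin (3 * n)) (Fin (3 * n)) (Unitized A))ˣ) :
      Matrix (Fin (3 * n)) (Fin (3 * n)) (Unitized A)) (finProdFinEquiv i) (finProdFinEquiv j)
      = h (((u : (Matrix (Fin n) (Fin n) (Unitized A))ˣ) :
        Matrix (Fin n) (Fin n) (Unitized A)) i.2 j.2) i.1 j.1 :=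
  tripleHom_apply h _ i j

theorem continuous_tripleHom {T R S : Type*} [TopologicalSpace T] [Ring R] [Ring S]
    [TopologicalSpace S] {H : T → R →+* Matrix (Fin 3) (Fin 3) S}
    (hc : ∀ x, Continuous fun t => H t x) {n : ℕ} (M : Matrix (Fin n) (Fin n) R) :
    Continuous fun t => tripleHom (H t) n M :=
  continuous_matrix fun _ _ => (hc _).matrix_elem _ _

theorem inv_mul_mem_connectedComponentOfOne {T G : Type*} [TopologicalSpace T]
    [PreconnectedSpace T] [TopologicalSpace G] [Group G] [IsTopologicalGroup G] {g : T → G}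
    (hg : Continuous g) (s t : T) : (g s)⁻¹ * g t ∈ Subgroup.connectedComponentOfOne G := by
  have hc : Continuous fun t => (g s)⁻¹ * g t := continuous_const.mul hg
  exact (isPreconnected_range hc).subset_connectedComponent ⟨s, inv_mul_cancel _⟩ ⟨t, rfl⟩

/-- Compatibility with the augmentation keeps the image of `u` inside `GL_{3n}(A)` along the whole
path, so its endpoints differ by an element of the identity component. -/
theorem AugHomotopic.inv_mul_mem {h h' : Unitized A →+* Matrix (Fin 3) (Fin 3) (Unitized A)}
    (H : AugHomotopic h h')
    (hh : ∀ x i j, augmentation A (h x i j) = if i = j then augmentation A x else 0)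
    (hh' : ∀ x i j, augmentation A (h' x i j) = if i = j then augmentation A x else 0)
    {n : ℕ} (u : GLn A n) :
    (tripleGL hh n u)⁻¹ * tripleGL hh' n u ∈ Subgroup.connectedComponentOfOne (GLn A (3 * n)) := by
  obtain ⟨H, hc, haug, ⟨s, rfl⟩, ⟨t, rfl⟩⟩ := H
  refine inv_mul_mem_connectedComponentOfOne (g := fun s => tripleGL (haug s) n u) ?_ s t
  -- In the unit group the inverse must vary continuously too. It is the image of `u⁻¹` under the
  -- same homomorphisms, so one lemma covers both.
  refine continuous_induced_rng.2 (Units.continuous_iff.2 ⟨?_, ?_⟩)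
  · exact continuous_tripleHom hc _
  · exact continuous_tripleHom hc _

theorem augmentation_diagonal (g : Fin 3 → A →ₙₐ[ℂ] A) (x : Unitized A) (i j : Fin 3) :
    augmentation A (unitizedMatrixHom (diagonalHom g) (diagonalHom_apply_mem g) x i j)
      = if i = j then augmentation A x else 0 :=
  augmentation_unitizedMatrixHom _ _ x i j

/-- The homomorphism `u ↦ diag(g₀ u, g₁ u, g₂ u)` from `GL_n(A)` to `GL_{3n}(A)`. -/
noncomputable abbrev diagonalGL (g : Fin 3 → A →ₙₐ[ℂ] A) (n : ℕ) : GLn A n →* GLn A (3 * n) :=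
  tripleGL (augmentation_diagonal g) n

theorem diagonalGL_apply (g : Fin 3 → A →ₙₐ[ℂ] A) {n : ℕ} (u : GLn A n) (i j : Fin 3 × Fin n) :
    ((diagonalGL g n u : (Matrix (Fin (3 * n)) (Fin (3 * n)) (Unitized A))ˣ) :
      Matrix (Fin (3 * n)) (Fin (3 * n)) (Unitized A)) (finProdFinEquiv i) (finProdFinEquiv j)
      = if i.1 = j.1 then unitizedHom (g i.1) (((u : (Matrix (Fin n) (Fin n) (Unitized A))ˣ) :
        Matrix (Fin n) (Fin n) (Unitized A)) i.2 j.2) else 0 := by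
  rw [tripleGL_apply, unitizedMatrixHom_diagonalHom, Matrix.diagonal_apply]

theorem unitizedHom_zero_GLn {n : ℕ} (u : GLn A n) (i j : Fin n) :
    unitizedHom (0 : A →ₙₐ[ℂ] A) (((u : (Matrix (Fin n) (Fin n) (Unitized A))ˣ) :
      Matrix (Fin n) (Fin n) (Unitized A)) i j) = (1 : Matrix (Fin n) (Fin n) (Unitized A)) i j := by
  rw [unitizedHom_zero_apply, GLn.augmentation_apply, Matrix.one_apply, Matrix.one_apply]
  split_ifs <;> simp

theorem le_three_mul (n : ℕ) : n ≤ 3 * n := by omega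

theorem diagonalGL_head {n : ℕ} (u : GLn A n) :
    diagonalGL ![NonUnitalAlgHom.id ℂ A, 0, 0] n u = stabGL A (le_three_mul n) u := by
  refine Subtype.ext (Units.ext (matrix_triple_ext ?_))
  rintro ⟨a, i⟩ ⟨b, j⟩
  rw [diagonalGL_apply]
  change _ = stabMatrix _ _ _ _
  have hi := i.2
  have hj := j.2
  simp only [stabMatrix, MonoidHom.coe_mk, OneHom.coe_mk, Matrix.of_apply,
    EmbeddingLike.apply_eq_iff_eq, Prod.mk.injEq]
  -- `finProdFinEquiv` sends `(a, i)` to `i + n * a`, so block `0` consists exactly of the indices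
  -- below `n`, where stabilization keeps the matrix.
  have e0 : ∀ (i : Fin n), ((finProdFinEquiv ((0 : Fin 3), i) : Fin (3 * n)) : ℕ) < n := fun i => by
    simp [finProdFinEquiv]
  have e1 : ∀ (a : Fin 3) (i : Fin n), a ≠ 0 →
      ¬ ((finProdFinEquiv (a, i) : Fin (3 * n)) : ℕ) < n := fun a i ha => by
    have : 1 ≤ (a : ℕ) := Nat.one_le_iff_ne_zero.2 fun h => ha (Fin.ext h)
    simp only [finProdFinEquiv, Equiv.coe_fn_mk, not_lt]
    nlinarith
  by_cases ha : a = 0 <;> by_cases hb : b = 0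
  · subst ha hb
    rw [dif_pos (e0 i), dif_pos (e0 j)]
    simp only [if_true, Matrix.cons_val_zero, unitizedHom_id, RingHom.id_apply]
    congr 1
  · subst ha
    rw [dif_pos (e0 i), dif_neg (e1 b j hb), if_neg (Ne.symm hb)]
  · subst hb
    rw [dif_neg (e1 a i ha), if_neg ha, if_neg (fun h => ha h.1)]
  · rw [dif_neg (e1 a i ha)]
    have hg : (![NonUnitalAlgHom.id ℂ A, 0, 0] : Fin 3 → A →ₙₐ[ℂ] A) a = 0 := by
      fin_cases a
      · exact absurd rfl ha
      · rfl
      · rfl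
    rw [hg, unitizedHom_zero_GLn, Matrix.one_apply]
    split_ifs <;> tauto

/-- The extension of the zero map sends an element of `GL_n(A)` to the identity, so the factors are
`diag(u, 1, 1)` and `diag(1, φ u, 1)`. -/
theorem diagonalGL_mul (φ : A →ₙₐ[ℂ] A) {n : ℕ} (u : GLn A n) :
    diagonalGL ![NonUnitalAlgHom.id ℂ A, 0, 0] n u * diagonalGL ![0, φ, 0] n u
      = diagonalGL ![NonUnitalAlgHom.id ℂ A, φ, 0] n u := by
  refine Subtype.ext (Units.ext (matrix_triple_ext ?_))
  rintro ⟨a, i⟩ ⟨b, j⟩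
  rw [diagonalGL_apply]
  change (_ * _ : Matrix (Fin (3 * n)) (Fin (3 * n)) (Unitized A)) _ _ = _
  rw [Matrix.mul_apply, ← finProdFinEquiv.sum_comp, Fintype.sum_prod_type]
  simp only [diagonalGL_apply]
  by_cases hab : a = b
  · subst hab
    rw [Finset.sum_eq_single a (fun c _ hc => by simp [hc.symm]) (by simp)]
    simp only [if_true]
    fin_cases a
    · simp [unitizedHom_id, unitizedHom_zero_GLn, Matrix.one_apply]
    · simp [unitizedHom_zero_GLn, Matrix.one_apply]
    · simp [unitizedHom_zero_GLn, Matrix.one_apply]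
  · rw [if_neg hab]
    refine Finset.sum_eq_zero fun c _ => Finset.sum_eq_zero fun k _ => ?_
    split_ifs with h1 h2
    · exact absurd (h1.trans h2) hab
    all_goals simp

/-- Every class in the direct limit has a representative `u` at some finite stage, and passing to
stage `3n` does not change its class. -/
theorem subsingleton_BanachK1_of_stabGL_mem (h : ∀ (n : ℕ) (u : GLn A n),
    stabGL A (le_three_mul n) u ∈ Subgroup.connectedComponentOfOne (GLn A (3 * n))) :
    Subsingleton (BanachK1 A) := by
  have key : ∀ x : BanachK1 A, x = ⟦⟨0, 1⟩⟧ := by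
    intro x
    obtain ⟨n, y, rfl⟩ := DirectLimit.exists_eq_mk _ x
    obtain ⟨u, rfl⟩ := QuotientGroup.mk_surjective y
    rw [DirectLimit.eq_of_le (f := piZeroStab A) ⟨n, _⟩ (3 * n) (le_three_mul n),
      DirectLimit.eq_of_le (f := piZeroStab A) ⟨0, 1⟩ (3 * n) (Nat.zero_le _)]
    refine congrArg (fun z => (⟦⟨3 * n, z⟩⟧ : BanachK1 A)) ?_
    rw [map_one]
    exact (QuotientGroup.eq_one_iff _).2 (h n u)
  exact ⟨fun x y => (key x).trans (key y).symm⟩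

end GeneralLinear

/-! ### The swindle -/

section Swindle

variable {B : Type*} [NormedRing B] [NormedAlgebra ℂ B]

/-- Data for an Eilenberg swindle on `A ⊆ B`: an endomorphism `φ` of `A`, thought of as an infinite
repetition, with `φ a = v a vInv + w (φ a) wInv` for isometries `v`, `w` with complementary ranges
that multiply `A` into itself. -/
structure EilenbergSwindle (A : NonUnitalSubalgebra ℂ B) where
  /-- The infinite repetition. -/
  φ : A →ₙₐ[ℂ] A
  /-- The inclusion of the first copy. -/
  v : B
  /-- The left inverse of `v`. -/
  vInv : B
  /-- The shift of the copies. -/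
  w : B
  /-- The left inverse of `w`. -/
  wInv : B
  v_mem : v ∈ multiplierAlgebra A
  vInv_mem : vInv ∈ multiplierAlgebra A
  w_mem : w ∈ multiplierAlgebra A
  wInv_mem : wInv ∈ multiplierAlgebra A
  vInv_mul_v : vInv * v = 1
  wInv_mul_w : wInv * w = 1
  vInv_mul_w : vInv * w = 0
  wInv_mul_v : wInv * v = 0
  add_eq_one : v * vInv + w * wInv = 1
  φ_eq : ∀ a : A, v * a * vInv + w * φ a * wInv = φ a

namespace EilenbergSwindle

variable {A : NonUnitalSubalgebra ℂ B}

theorem augHomotopic_absorb (E : EilenbergSwindle A) :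
    AugHomotopic (unitizedMatrixHom (diagonalHom ![NonUnitalAlgHom.id ℂ A, E.φ, 0])
        (diagonalHom_apply_mem _))
      (unitizedMatrixHom (diagonalHom ![0, 0, E.φ]) (diagonalHom_apply_mem _)) := by
  -- The row `(v, w)` identifies two copies of the module with one, and `U` exchanges the first two
  -- blocks with the third along it. The relations between `v`, `w` and their left inverses say `U *
  -- U = 1`. The only surviving block of the conjugate is `v a vInv + w (φ a) wInv`.
  refine augHomotopic_of_involution _ _ (U := !![0, 0, E.vInv; 0, 0, E.wInv; E.v, E.w, 0]) ?_ ?_ ?_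
  · intro i j
    fin_cases i <;> fin_cases j <;>
      simp [E.v_mem, E.vInv_mem, E.w_mem, E.wInv_mem, zero_mem]
  · ext i j
    fin_cases i <;> fin_cases j <;>
      simp [Matrix.mul_apply, Fin.sum_univ_three, E.vInv_mul_v, E.wInv_mul_w, E.vInv_mul_w,
        E.wInv_mul_v, E.add_eq_one]
  · intro a
    ext i j
    have := E.φ_eq a
    fin_cases i <;> fin_cases j <;>
      simp [Matrix.mul_apply, Fin.sum_univ_three, Matrix.vecMul_diagonal, diagonalHom_apply, this]

/-- For `K₁` the block `φ u` must return from the third to the second position, where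
`diagonalGL_mul` can cancel it. For `K₀` commutativity of addition does this. -/
theorem augHomotopic_swap (φ : A →ₙₐ[ℂ] A) :
    AugHomotopic (unitizedMatrixHom (diagonalHom ![0, 0, φ]) (diagonalHom_apply_mem _))
      (unitizedMatrixHom (diagonalHom ![0, φ, 0]) (diagonalHom_apply_mem _)) := by
  refine augHomotopic_of_involution _ _ (U := !![1, 0, 0; 0, 0, 1; 0, 1, 0]) ?_ ?_ ?_
  · intro i j
    fin_cases i <;> fin_cases j <;> simp [one_mem, zero_mem]
  · ext i j
    fin_cases i <;> fin_cases j <;> simp [Matrix.mul_apply, Fin.sum_univ_three]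
  · intro a
    ext i j
    fin_cases i <;> fin_cases j <;>
      simp [Matrix.mul_apply, Fin.sum_univ_three, Matrix.vecMul_diagonal, diagonalHom_apply]

theorem subsingleton_BanachK0 (E : EilenbergSwindle A) [CompleteSpace A] :
    Subsingleton (BanachK0 A) := by
  refine subsingleton_BanachK0_of_map_eq fun e => ?_
  have h := congrArg Algebra.GrothendieckAddGroup.of (E.augHomotopic_absorb.toClass_eq e)
  have hid : e.map (unitizedHom (NonUnitalAlgHom.id ℂ A)) = e := by
    rw [unitizedHom_id]
    rfl
  simp only [Matrix.cons_val_zero, Matrix.cons_val_one, Matrix.cons_val, hid, map_add] at h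
  -- Now `[e] + x = [e₀] + x`, with `e₀` the scalar part of `e` and `x = [e₀] + [φ e]`. Cancellation
  -- is legitimate because the classes are taken in the Grothendieck group.
  rw [add_comm (Algebra.GrothendieckAddGroup.of (e.map (unitizedHom E.φ)).toClass)] at h
  exact add_right_cancel h

theorem subsingleton_BanachK1 (E : EilenbergSwindle A) : Subsingleton (BanachK1 A) := by
  refine subsingleton_BanachK1_of_stabGL_mem fun n u => ?_
  have h1 := E.augHomotopic_absorb.inv_mul_mem (augmentation_diagonal _)
    (augmentation_diagonal _) u
  have h2 := (augHomotopic_swap E.φ).inv_mul_mem (augmentation_diagonal _)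
    (augmentation_diagonal _) u
  have h3 := mul_mem h1 h2
  rw [mul_assoc, mul_inv_cancel_left] at h3
  have h4 := diagonalGL_mul E.φ u
  rw [diagonalGL_head] at h4
  rw [← h4, mul_inv_rev] at h3
  -- With `a = diag(u, 1, 1)` and `b = diag(1, φ u, 1)`, the two homotopies have given `(a b)⁻¹ b =
  -- b⁻¹ a⁻¹ b` in the identity component. Normality then yields `a⁻¹`.
  have h5 := (connectedComponentOfOne_normal (GLn A (3 * n))).conj_mem _ h3
    (diagonalGL ![0, E.φ, 0] n u)
  have h6 : ∀ a b : GLn A (3 * n), b * (b⁻¹ * a⁻¹ * b) * b⁻¹ = a⁻¹ := fun a b => by group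
  rw [h6] at h5
  exact inv_mem_iff.1 h5

end EilenbergSwindle

end Swindle

/-! ### The swindle on the Roe algebra -/

section RoeAlgebra

variable {X : Type*} {𝓔 : CoarseStructure X} {Z : Set X}

/-- The shift takes a point near `α k a` to one near `α (k + 1) a`, so it moves points along `O⁻¹`,
then `C`, then `O`. Points in no copy stay on the diagonal. -/
theorem exists_controlled_shift {α : ℕ → X → X} (hstep : 𝓔.UniformlyCloseSteps α)
    {τ : ℕ × (Z × ℕ) → Z × ℕ} (hτ : Function.Injective τ) {O : Set (X × X)}
    (hO : O ∈ 𝓔.controlled) (hclose : ∀ k a, (α k a.1, ((τ (k, a)).1 : X)) ∈ O) :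
    ∃ S ∈ 𝓔.controlled, ∀ a, ((a.1 : X), ((shiftMap τ a).1 : X)) ∈ S := by
  obtain ⟨C, hC, hCα⟩ := hstep
  refine ⟨_, 𝓔.union_mem 𝓔.diagonal_mem (𝓔.comp_mem (𝓔.inv_mem hO) (𝓔.comp_mem hC hO)),
    fun b => ?_⟩
  by_cases hb : b ∈ range τ
  · obtain ⟨⟨k, a⟩, rfl⟩ := hb
    rw [shiftMap_apply hτ]
    exact Or.inr ⟨_, hclose k a, _, hCα k a.1, hclose (k + 1) a⟩
  · rw [shiftMap_of_notMem hb]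
    exact Or.inl rfl

variable [TopologicalSpace X] {p : ℝ≥0∞} [Fact (1 ≤ p)]

theorem map_mem_roeAlgebra (h𝓔 : 𝓔.IsProper) (hp : p ≠ ∞)
    {f : (LpModule Z p →L[ℂ] LpModule Z p) → (LpModule Z p →L[ℂ] LpModule Z p)}
    (hf : Continuous f)
    (h : ∀ T ∈ algebraicRoe 𝓔 h𝓔 Z p hp, f T ∈ algebraicRoe 𝓔 h𝓔 Z p hp)
    {T : LpModule Z p →L[ℂ] LpModule Z p} (hT : T ∈ roeAlgebra 𝓔 h𝓔 Z p hp) :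
    f T ∈ roeAlgebra 𝓔 h𝓔 Z p hp :=
  map_mem_closure hf hT h

/-- Controlled operators are multipliers of the Roe algebra. -/
theorem IsControlledOp.mem_multiplierAlgebra (h𝓔 : 𝓔.IsProper) (hp : p ≠ ∞)
    {m : LpModule Z p →L[ℂ] LpModule Z p} (hm : IsControlledOp 𝓔 m) :
    m ∈ multiplierAlgebra (roeAlgebra 𝓔 h𝓔 Z p hp) := fun _ hT =>
  ⟨map_mem_roeAlgebra h𝓔 hp (continuous_const_mul m) (fun _ => hm.mul_mem_algebraicRoe h𝓔 hp) hT,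
    map_mem_roeAlgebra h𝓔 hp (continuous_mul_const m) (fun _ => hm.mem_algebraicRoe_mul h𝓔 hp) hT⟩

/-- The swindle on the Roe algebra given by injections `τ (k, ·)` of `Z × ℕ` with disjoint ranges
that are close to `α k`. -/
noncomputable def roeSwindle (h𝓔 : 𝓔.IsProper) (hp : p ≠ ∞) {α : ℕ → X → X}
    (hα : ∀ k, 𝓔.IsCoarseMap 𝓔 (α k)) (hα₀ : α 0 = id) (hsupp : 𝓔.ProperlySupported α)
    (hctrl : 𝓔.UniformlyControlled α) (hstep : 𝓔.UniformlyCloseSteps α)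
    {τ : ℕ × (Z × ℕ) → Z × ℕ} (hτ : Function.Injective τ) {O : Set (X × X)}
    (hO : O ∈ 𝓔.controlled) (hclose : ∀ k a, (α k a.1, ((τ (k, a)).1 : X)) ∈ O) :
    EilenbergSwindle (roeAlgebra 𝓔 h𝓔 Z p hp) :=
  have hmem : ∀ T ∈ roeAlgebra 𝓔 h𝓔 Z p hp, lpSwindle hp τ hτ T ∈ roeAlgebra 𝓔 h𝓔 Z p hp :=
    fun T hT => map_mem_roeAlgebra h𝓔 hp
      (AddMonoidHomClass.continuous_of_bound (lpSwindle hp τ hτ) 1 fun T => by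
        rw [one_mul]
        exact norm_lpSwindle_le hp τ hτ T)
      (fun _ => lpSwindle_mem_algebraicRoe hτ hp h𝓔 hα hsupp hctrl hO hclose) hT
  have hhead : ∀ a, ((a.1 : X), ((τ (0, a)).1 : X)) ∈ O := fun a => by
    have := hclose 0 a
    rwa [hα₀] at this
  have hshift := exists_controlled_shift hstep hτ hO hclose
  { φ := NonUnitalAlgHom.codRestrict ((lpSwindle hp τ hτ).comp
      (NonUnitalSubalgebraClass.subtype (roeAlgebra 𝓔 h𝓔 Z p hp))) _ fun T => hmem T T.2
    v := lpExt hp _ (injective_slice hτ 0)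
    vInv := lpRes hp _ (injective_slice hτ 0)
    w := lpExt hp _ (shiftMap_injective hτ)
    wInv := lpRes hp _ (shiftMap_injective hτ)
    v_mem := (isControlledOp_lpExt h𝓔 hp _ hO hhead).mem_multiplierAlgebra h𝓔 hp
    vInv_mem := (isControlledOp_lpRes h𝓔 hp _ hO hhead).mem_multiplierAlgebra h𝓔 hp
    w_mem := by
      obtain ⟨S, hS, h⟩ := hshift
      exact (isControlledOp_lpExt h𝓔 hp _ hS h).mem_multiplierAlgebra h𝓔 hp
    wInv_mem := by
      obtain ⟨S, hS, h⟩ := hshift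
      exact (isControlledOp_lpRes h𝓔 hp _ hS h).mem_multiplierAlgebra h𝓔 hp
    vInv_mul_v := ContinuousLinearMap.ext fun ξ => lpRes_lpExt hp _ _ ξ
    wInv_mul_w := ContinuousLinearMap.ext fun ξ => lpRes_lpExt hp _ _ ξ
    vInv_mul_w := ContinuousLinearMap.ext fun ξ =>
      lpRes_lpExt_of_disjoint hp _ (shiftMap_injective hτ) _ (injective_slice hτ 0)
        (fun a b => (ne_shiftMap hτ b a).symm) ξ
    wInv_mul_v := ContinuousLinearMap.ext fun ξ =>
      lpRes_lpExt_of_disjoint hp _ (injective_slice hτ 0) _ (shiftMap_injective hτ)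
        (ne_shiftMap hτ) ξ
    add_eq_one := ContinuousLinearMap.ext fun ξ => head_add_shift hp hτ ξ
    φ_eq := fun T => ContinuousLinearMap.ext fun ξ => lpSwindle_eq hp hτ T ξ }

/-- A sequence of self-maps of `X` can be approximated on a countable dense set `Z` by injections of
`Z × ℕ` with disjoint ranges. -/
theorem exists_injective_close {Z : Set X} (hZc : Z.Countable) (hZd : Dense Z) (α : ℕ → X → X)
    {O : Set (X × X)} (hOo : IsOpen O) (hOd : diagonal X ⊆ O) :
    ∃ τ : ℕ × (Z × ℕ) → Z × ℕ, Function.Injective τ ∧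
      ∀ k a, (α k a.1, ((τ (k, a)).1 : X)) ∈ O := by
  have : Countable Z := hZc
  have h : ∀ x : X, ∃ z : Z, (x, (z : X)) ∈ O := fun x => by
    obtain ⟨z, hz, hzZ⟩ := hZd.inter_open_nonempty {y | (x, y) ∈ O}
      (hOo.preimage (Continuous.prodMk_right x)) ⟨x, hOd (mem_diagonal x)⟩
    exact ⟨⟨z, hzZ⟩, hz⟩
  choose β hβ using h
  -- The `ℕ`-coordinate of the target encodes the whole index `(k, z, n)`. This makes `τ` injective
  -- whatever `α k` and `β` identify.
  obtain ⟨c, hc⟩ := exists_injective_nat (ℕ × (Z × ℕ))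
  exact ⟨fun q => (β (α q.1 q.2.1), c q), fun q r hqr => hc (congrArg Prod.snd hqr),
    fun k a => hβ _⟩

instance (h𝓔 : 𝓔.IsProper) (hp : p ≠ ∞) : CompleteSpace (roeAlgebra 𝓔 h𝓔 Z p hp) :=
  (NonUnitalSubalgebra.isClosed_topologicalClosure _).completeSpace_coe

end RoeAlgebra

theorem lemma3p11 {X : Type*} [TopologicalSpace X] [T2Space X] [TopologicalSpace.SeparableSpace X]
    (𝓔 : CoarseStructure X) (h𝓔 : 𝓔.IsProper)
    (p : ℝ≥0∞) [Fact (1 ≤ p)] (hp : p ≠ ∞)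
    (Z : Set X) (hZc : Z.Countable) (hZd : Dense Z)
    (α : ℕ → X → X) (hα : ∀ k, 𝓔.IsCoarseMap 𝓔 (α k)) (hα₀ : α 0 = id)
    (hsupp : 𝓔.ProperlySupported α) (hctrl : 𝓔.UniformlyControlled α)
    (hstep : 𝓔.UniformlyCloseSteps α) :
    Subsingleton (BanachK0 (roeAlgebra 𝓔 h𝓔 Z p hp)) ∧
      Subsingleton (BanachK1 (roeAlgebra 𝓔 h𝓔 Z p hp)) := by
  obtain ⟨O, hO, hOo, hOd⟩ := h𝓔.exists_open
  obtain ⟨τ, hτ, hclose⟩ := exists_injective_close hZc hZd α hOo hOd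
  have E := roeSwindle h𝓔 hp hα hα₀ hsupp hctrl hstep hτ hO hclose
  exact ⟨E.subsingleton_BanachK0, E.subsingleton_BanachK1⟩
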